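/- Let $d\ge 1$ and let $\Omega\subset\mathbb{R}^d$ be a nonempty bounded uniform domain. Write $d_\Omega(x)=\operatorname{dist}(x,\partial\Omega)$. Here a connected open set $\Omega$ is a *uniform domain* if there is a constant $K\ge 1$ such that any two points $x,y\in\Omega$ are joined by a curve $\gamma:[0,l]\to\Omega$, parametrized by arc length, with $l\le K|x-y|$ and $d_\Omega(z)\ge \frac1K\min\{|z-x|,|z-y|\}$ for every point $z$ of $\gamma$. The *lower Assouad codimension* $\underline{\operatorname{co\,dim}}_A(E)$ of a set $E\subset\mathbb{R}^d$ is the supremum of all $q\ge 0$ for which there is a constant $c\ge1$ such that $$\bigl|\{z:\operatorname{dist}(z,E)\le r\}\cap B(x,R)\bigr|\le c\,|B(x,R)|\Bigl(\frac rR\Bigr)^q\qquad\text{for all }x\in E\text{ and }0<r<R<\operatorname{diam}E .$$ Let $0<s<1$, $1\le p<\infty$, $0<\theta\le 1$ and $0\le\alpha,\beta<\underline{\operatorname{co\,dim}}_A(\partial\Omega)$. Then the full and the truncated weighted Gagliardo seminorms are comparable: there is a constant $C=C(\theta,d,s,p,\alpha,\beta,\Omega)>0$ such that for every (real- or complex-valued)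 $f\in L^1_{\mathrm{loc}}(\Omega)$ $$\int_\Omega\int_{\Omega}\frac{|f(x)-f(y)|^p}{|x-y|^{d+sp}}\,\frac{dy}{d_\Omega(y)^{\beta}}\,\frac{dx}{d_\Omega(x)^{\alpha}}\;\le\; C\int_\Omega\int_{B(x,\theta d_\Omega(x))}\frac{|f(x)-f(y)|^p}{|x-y|^{d+sp}}\,\frac{dy}{d_\Omega(y)^{\beta}}\,\frac{dx}{d_\Omega(x)^{\alpha}},$$ where both sides are values in $[0,\infty]$, and conversely the integral on the right-hand side (without the factor $C$) is at most the integral on the left-hand side. -/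

import Mathlib

open MeasureTheory Set
open scoped NNReal ENNReal

noncomputable section

/-- `ℝᵈ` with its Euclidean norm. -/
abbrev Euc (d : ℕ) : Type := EuclideanSpace ℝ (Fin d)

/-- `d_Ω(x) = dist(x, ∂Ω)`, the distance from `x` to the boundary of `Ω`. -/
def bdryDist {d : ℕ} (Ω : Set (Euc d)) (x : Euc d) : ℝ :=
  Metric.infDist x (frontier Ω)

/-- The condition on an exponent `q ≥ 0` in the definition of the lower Assouad codimension:
there is a constant `C ≥ 1` with `|{dist(·, E) ≤ r} ∩ B(x, R)| ≤ C |B(x, R)| (r / R)^q`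
for all `x ∈ E` and `0 < r < R < diam E`. The diameter is taken in `[0, ∞]`. -/
def AssouadCodimBound {d : ℕ} (E : Set (Euc d)) (q : ℝ≥0) : Prop :=
  ∃ C : ℝ, 1 ≤ C ∧ ∀ x ∈ E, ∀ r R : ℝ, 0 < r → r < R → ENNReal.ofReal R < Metric.ediam E →
    volume (Metric.cthickening r E ∩ Metric.ball x R) ≤
      ENNReal.ofReal (C * (r / R) ^ (q : ℝ)) * volume (Metric.ball x R)

/-- The lower Assouad codimension of `E ⊆ ℝᵈ`: the supremum, in `[0, ∞]`, of all `q ≥ 0` that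
satisfy `AssouadCodimBound E q`. -/
def lowerAssouadCodim {d : ℕ} (E : Set (Euc d)) : ℝ≥0∞ :=
  ⨆ (q : ℝ≥0) (_ : AssouadCodimBound E q), (q : ℝ≥0∞)

/-- Uniform domains: `Ω` is open and connected, and for some `C ≥ 1` any two points
`x, y ∈ Ω` are joined by a curve `γ : [0, l] → Ω`, parametrized by arc length, with
`l ≤ C |x - y|` and `dist(z, ∂Ω) ≥ C⁻¹ min {|z - x|, |z - y|}` for every `z` on `γ`. -/
structure IsUniformDomain {d : ℕ} (Ω : Set (Euc d)) : Prop where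
  isOpen : IsOpen Ω
  isPreconnected : IsPreconnected Ω
  exists_curve : ∃ C : ℝ, 1 ≤ C ∧ ∀ x ∈ Ω, ∀ y ∈ Ω, ∃ (l : ℝ) (γ : ℝ → Euc d),
    0 ≤ l ∧ HasUnitSpeedOn γ (Icc 0 l) ∧ MapsTo γ (Icc 0 l) Ω ∧ γ 0 = x ∧ γ l = y ∧
      l ≤ C * dist x y ∧
      ∀ t ∈ Icc 0 l, 1 / C * min (dist (γ t) x) (dist (γ t) y) ≤ bdryDist Ω (γ t)

/-- The integrand `|f(x) - f(y)|^p / |x - y|^(d + s p) * d_Ω(y)^(-β) * d_Ω(x)^(-α)`. -/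
def gagliardoIntegrand {d : ℕ} {𝕜 : Type*} [RCLike 𝕜] (Ω : Set (Euc d)) (s p α β : ℝ)
    (f : Euc d → 𝕜) (x y : Euc d) : ℝ≥0∞ :=
  ENNReal.ofReal (‖f x - f y‖ ^ p / dist x y ^ ((d : ℝ) + s * p) *
    bdryDist Ω y ^ (-β) * bdryDist Ω x ^ (-α))

/-- The `p`-th power of the full weighted Gagliardo seminorm, a value in `[0, ∞]`. -/
def fullSeminormPow {d : ℕ} {𝕜 : Type*} [RCLike 𝕜] (Ω : Set (Euc d)) (s p α β : ℝ)
    (f : Euc d → 𝕜) : ℝ≥0∞ :=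
  ∫⁻ x in Ω, ∫⁻ y in Ω, gagliardoIntegrand Ω s p α β f x y

/-- The `p`-th power of the truncated weighted Gagliardo seminorm, in which `y` runs only over
the ball `B(x, θ d_Ω(x))`, a value in `[0, ∞]`. -/
def truncatedSeminormPow {d : ℕ} {𝕜 : Type*} [RCLike 𝕜] (Ω : Set (Euc d)) (s p α β θ : ℝ)
    (f : Euc d → 𝕜) : ℝ≥0∞ :=
  ∫⁻ x in Ω, ∫⁻ y in Metric.ball x (θ * bdryDist Ω x), gagliardoIntegrand Ω s p α β f x y

end

/-! ### Distance to the boundary and volumes of balls -/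

section Geometry

variable {d : ℕ} {Ω : Set (Euc d)}

/-! Write δ for `bdryDist Ω`. The truncated seminorm is at most the full one because B(x, θδ(x)) ⊆
Ω. For the other direction only pairs with |x - y| ≥ θδ(x) matter, and for them f(x) - f(y) is
telescoped along a chain of balls that climbs from x to the scale |x - y|, crosses over, and
descends to y.

The chain consists of points rather than ball averages. Let G(u) = ∫_{B(u, κδ(u))} |f(u) - f(v)|^p
dv (`localOsc`). By Chebyshev, each ball of the chain contains a point at which both the increment
from the previous point and G are at most four times their averages (`exists_step`). Uniformity
provides corkscrew points at all dyadic scales and bounds the number of steps between consecutive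
scales (`UniformWith.exists_travel`, `UniformWith.exists_climb`). The outcome is
`UniformWith.edist_rpow_le`: for any t > 0, |f(x) - f(y)|^p is at most a constant times a sum over k
of 2^(tpk) times the normalized size of G near x and near y at the scale 2^(-k)|x - y|.

This bound is integrated against the kernel with the order of integration exchanged. At level k, a
fixed u sees x in a ball of radius about δ(u) and y in a ball of radius about 2^k δ(u). The
codimension hypothesis makes δ^(-β) integrate to at most C R^(d-β) over Ω ∩ B(u, R) when R ≥ δ(u)
(`exists_weight_bound`), and likewise for α. So level k contributes at most a multiple of 2^(-spk) ∫
G δ^(-d-sp-α-β) (`lintegral_kernel_scaleAvg_le`), and with t = s/2 the series converges. The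
remaining integral is controlled by the truncated seminorm (`lintegral_localOsc_le`), since |u - v|
< κδ(u) and δ(v) ≤ 2δ(u) on the balls that define G. -/

theorem bdryDist_nonneg (x : Euc d) : 0 ≤ bdryDist Ω x := Metric.infDist_nonneg

theorem bdryDist_le_add_dist (x y : Euc d) : bdryDist Ω x ≤ bdryDist Ω y + dist x y :=
  Metric.infDist_le_infDist_add_dist

theorem continuous_bdryDist : Continuous (bdryDist Ω) := Metric.continuous_infDist_pt _

theorem frontier_nonempty_of_isBounded (hd : 1 ≤ d) (hne : Ω.Nonempty)
    (hbdd : Bornology.IsBounded Ω) : (frontier Ω).Nonempty := by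
  have : Nonempty (Fin d) := ⟨⟨0, hd⟩⟩
  refine nonempty_frontier_iff.2 ⟨hne, fun h => ?_⟩
  exact NormedSpace.unbounded_univ ℝ (Euc d) (h ▸ hbdd)

theorem bdryDist_pos (hΩ : IsOpen Ω) (hF : (frontier Ω).Nonempty) {x : Euc d} (hx : x ∈ Ω) :
    0 < bdryDist Ω x := by
  refine (isClosed_frontier.notMem_iff_infDist_pos hF).1 fun h => ?_
  rw [hΩ.frontier_eq] at h
  exact h.2 hx

/-- The ball is connected, meets Ω at its centre and misses the frontier, so it cannot leave Ω. -/
theorem ball_bdryDist_subset (hΩ : IsOpen Ω) {x : Euc d} (hx : x ∈ Ω) :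
    Metric.ball x (bdryDist Ω x) ⊆ Ω := by
  rcases (bdryDist_nonneg (Ω := Ω) x).eq_or_lt with h0 | h0
  · rw [← h0, Metric.ball_zero]
    exact empty_subset _
  refine ((convex_ball x (bdryDist Ω x)).isPreconnected).subset_of_closure_inter_subset hΩ
    ⟨x, Metric.mem_ball_self h0, hx⟩ fun y hy => ?_
  by_contra hyΩ
  have hyF : y ∈ frontier Ω := hΩ.frontier_eq ▸ ⟨hy.1, hyΩ⟩
  have hlt := hy.2
  rw [Metric.mem_ball, dist_comm] at hlt
  exact absurd (Metric.infDist_le_dist_of_mem hyF) (not_le.2 hlt)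

theorem ball_mul_bdryDist_subset (hΩ : IsOpen Ω) {κ : ℝ} (hκ : κ ≤ 1) {x : Euc d} (hx : x ∈ Ω) :
    Metric.ball x (κ * bdryDist Ω x) ⊆ Ω :=
  (Metric.ball_subset_ball (mul_le_of_le_one_left (bdryDist_nonneg x) hκ)).trans
    (ball_bdryDist_subset hΩ hx)

/-- The volume of the unit ball. -/
noncomputable def unitVol (d : ℕ) : ℝ := (volume (Metric.ball (0 : Euc d) 1)).toReal

theorem unitVol_pos (d : ℕ) : 0 < unitVol d :=
  ENNReal.toReal_pos (Metric.measure_ball_pos volume _ one_pos).ne' measure_ball_lt_top.ne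

theorem volume_ball_eq_ofReal (z : Euc d) {r : ℝ} (hr : 0 < r) :
    volume (Metric.ball z r) = ENNReal.ofReal (r ^ d * unitVol d) := by
  rw [Measure.addHaar_ball_of_pos volume z hr, ENNReal.ofReal_mul (by positivity), unitVol,
    ENNReal.ofReal_toReal measure_ball_lt_top.ne, finrank_euclideanSpace_fin]

end Geometry

/-! ### Choosing good points by Chebyshev's inequality -/

section Selection

variable {X : Type*} [MeasurableSpace X] {μ : Measure X}

/-- Markov's inequality. The strict inequality in the exceptional set covers the degenerate cases:
if the average is 0 then g vanishes a.e. on B, and if it is ∞ the set is empty. -/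
theorem measure_average_lt_le {B : Set X} (hB : MeasurableSet B) (h0 : μ B ≠ 0) (ht : μ B ≠ ∞)
    {g : X → ℝ≥0∞} (hg : Measurable g) :
    μ (B ∩ {v | 4 * (μ B)⁻¹ * ∫⁻ w in B, g w ∂μ < g v}) ≤ μ B / 4 := by
  set I := ∫⁻ w in B, g w ∂μ with hI
  have hinv0 : (μ B)⁻¹ ≠ 0 := ENNReal.inv_ne_zero.2 ht
  have hinvt : (μ B)⁻¹ ≠ ∞ := ENNReal.inv_ne_top.2 h0
  rcases eq_or_ne I 0 with h | h
  · rw [h, mul_zero]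
    have := (setLIntegral_eq_zero_iff hB hg).1 (hI.symm.trans h)
    rw [measure_mono_null ?_ (ae_iff.1 this)]
    · exact zero_le
    · rintro v ⟨hv, hv'⟩ h'
      exact (h' hv ▸ hv' : (0 : ℝ≥0∞) < 0).ne rfl
  rcases eq_or_ne I ∞ with h' | h'
  · rw [h', ENNReal.mul_top (mul_ne_zero (by norm_num) hinv0)]
    simp
  have hε0 : 4 * (μ B)⁻¹ * I ≠ 0 := mul_ne_zero (mul_ne_zero (by norm_num) hinv0) h
  have hεt : 4 * (μ B)⁻¹ * I ≠ ∞ :=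
    ENNReal.mul_ne_top (ENNReal.mul_ne_top (by norm_num) hinvt) h'
  have := meas_ge_le_lintegral_div (μ := μ.restrict B) hg.aemeasurable hε0 hεt
  rw [Measure.restrict_apply (measurableSet_le measurable_const hg), inter_comm, ← hI] at this
  refine (measure_mono (inter_subset_inter_right B fun v (hv : _ < g v) => hv.le)).trans
    (this.trans ?_)
  rw [ENNReal.div_le_iff hε0 hεt, ENNReal.div_eq_inv_mul]
  calc I = (4⁻¹ * 4) * (μ B * (μ B)⁻¹) * I := by
        rw [ENNReal.inv_mul_cancel (by norm_num) (by norm_num), ENNReal.mul_inv_cancel h0 ht,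
          one_mul, one_mul]
    _ ≤ 4⁻¹ * μ B * (4 * (μ B)⁻¹ * I) := le_of_eq (by ring)

/-- Two functions are simultaneously bounded by four times their averages at some point. -/
theorem exists_mem_le_four_mul_average {B : Set X} (hB : MeasurableSet B) (h0 : μ B ≠ 0)
    (ht : μ B ≠ ∞) {g h : X → ℝ≥0∞} (hg : Measurable g) (hh : Measurable h) :
    ∃ v ∈ B, g v ≤ 4 * (μ B)⁻¹ * ∫⁻ w in B, g w ∂μ ∧ h v ≤ 4 * (μ B)⁻¹ * ∫⁻ w in B, h w ∂μ := by
  by_contra! hcon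
  have hsub : B ⊆ (B ∩ {v | 4 * (μ B)⁻¹ * ∫⁻ w in B, g w ∂μ < g v}) ∪
      (B ∩ {v | 4 * (μ B)⁻¹ * ∫⁻ w in B, h w ∂μ < h v}) := fun v hv => by
    by_cases hv' : g v ≤ 4 * (μ B)⁻¹ * ∫⁻ w in B, g w ∂μ
    · exact Or.inr ⟨hv, hcon v hv hv'⟩
    · exact Or.inl ⟨hv, not_le.1 hv'⟩
  -- The two exceptional sets together fill at most half of B, so they cannot cover it.
  have h1 : μ B ≤ μ B / 4 + μ B / 4 := (measure_mono hsub).trans ((measure_union_le _ _).trans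
    (add_le_add (measure_average_lt_le hB h0 ht hg) (measure_average_lt_le hB h0 ht hh)))
  lift μ B to ℝ≥0 using ht with m
  have h4 : ((m : ℝ≥0∞) / 4) = ((m / 4 : ℝ≥0) : ℝ≥0∞) := by
    rw [ENNReal.coe_div (by norm_num)]; rfl
  rw [h4] at h1
  have h2 : m ≤ m / 4 + m / 4 := by exact_mod_cast h1
  have h3 : (m : ℝ) ≤ m / 4 + m / 4 := by exact_mod_cast h2
  have h5 : (m : ℝ) ≠ 0 := by exact_mod_cast h0
  have h6 : (0 : ℝ) ≤ m := m.2
  exact h5 (by linarith)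

end Selection

/-! ### Chains of points with controlled increments -/

section Chains

variable {d : ℕ} {Ω : Set (Euc d)} {F : Type*} [NormedAddCommGroup F] {f : Euc d → F}

/-- The `p`-th power oscillation of `f` around `u` at the scale `κ d_Ω(u)`. -/
noncomputable def localOsc (Ω : Set (Euc d)) (κ p : ℝ) (f : Euc d → F) (u : Euc d) : ℝ≥0∞ :=
  ∫⁻ v in Metric.ball u (κ * bdryDist Ω u), edist (f u) (f v) ^ p

theorem measurable_uncurry_edist_rpow (hf : StronglyMeasurable f) (p : ℝ) :
    Measurable fun z : Euc d × Euc d => edist (f z.1) (f z.2) ^ p := by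
  simp_rw [edist_eq_enorm_sub]
  exact (((hf.comp_measurable measurable_fst).sub
    (hf.comp_measurable measurable_snd)).enorm).pow_const p

theorem measurable_localOsc (hf : StronglyMeasurable f) (κ p : ℝ) :
    Measurable (localOsc Ω κ p f) := by
  have hS : MeasurableSet {z : Euc d × Euc d | dist z.2 z.1 < κ * bdryDist Ω z.1} :=
    measurableSet_lt (measurable_snd.dist measurable_fst)
      ((continuous_bdryDist.measurable.comp measurable_fst).const_mul κ)
  have := ((measurable_uncurry_edist_rpow hf p).indicator hS).lintegral_prod_right'
    (ν := (volume : Measure (Euc d)))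
  convert this using 2 with u
  rw [localOsc, ← lintegral_indicator measurableSet_ball]
  rfl

/-- The averaging factor of a ball of radius `τ`. -/
noncomputable def avgFactor (d : ℕ) (τ : ℝ) : ℝ≥0∞ := 4 * (volume (Metric.ball (0 : Euc d) τ))⁻¹

/-- A point w of the left ball satisfies |w - u| < 3τ, while κδ(u) ≥ κ(δ(z) - τ) ≥ 3τ. -/
theorem ball_subset_of_step {κ τ : ℝ} (hκ0 : 0 < κ) (hκ : κ ≤ 1) {z z' u : Euc d}
    (hz : 4 * τ ≤ κ * bdryDist Ω z) (hzz : dist z z' ≤ τ) (hu : u ∈ Metric.ball z τ) :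
    Metric.ball z' τ ⊆ Metric.ball u (κ * bdryDist Ω u) := by
  intro w hw
  rw [Metric.mem_ball] at hw hu ⊢
  have t1 : dist w u ≤ dist w z' + dist z' z + dist z u := dist_triangle4 _ _ _ _
  rw [dist_comm z' z, dist_comm z u] at t1
  have t2 := bdryDist_le_add_dist (Ω := Ω) z u
  rw [dist_comm z u] at t2
  nlinarith [dist_nonneg (x := u) (y := z)]

/-- The average of |f(u) - f(v)|^p over B(z', τ) is at most that ball's inverse volume times G(u),
because the ball lies inside the domain of integration of G(u). The free function `h` is taken to be
G when the chain has to go on, and an increment from a second point when two chains have to meet. -/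
theorem exists_step (hf : StronglyMeasurable f) {κ p τ : ℝ} (hκ0 : 0 < κ) (hκ : κ ≤ 1)
    (hp : 0 < p) (hτ : 0 < τ)
    {z z' u : Euc d} (hz : 4 * τ ≤ κ * bdryDist Ω z) (hzz : dist z z' ≤ τ)
    (hu : u ∈ Metric.ball z τ) {h : Euc d → ℝ≥0∞} (hh : Measurable h) {Q : ℝ≥0∞}
    (hQ : avgFactor d τ * localOsc Ω κ p f u ≤ Q ^ p) :
    ∃ v ∈ Metric.ball z' τ, edist (f u) (f v) ≤ Q ∧
      h v ≤ avgFactor d τ * ∫⁻ w in Metric.ball z' τ, h w := by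
  have hm : Measurable fun v => edist (f u) (f v) ^ p :=
    (measurable_uncurry_edist_rpow hf p).comp measurable_prodMk_left
  have hvol : volume (Metric.ball z' τ) = volume (Metric.ball (0 : Euc d) τ) :=
    Measure.addHaar_ball_center volume z' τ
  obtain ⟨v, hv, h1, h2⟩ := exists_mem_le_four_mul_average (μ := volume) measurableSet_ball
    (Metric.measure_ball_pos volume z' hτ).ne' measure_ball_lt_top.ne hm hh
  rw [hvol] at h1 h2
  refine ⟨v, hv, ?_, h2⟩
  have h3 : edist (f u) (f v) ^ p ≤ Q ^ p := h1.trans ((mul_le_mul_right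
    (lintegral_mono_set (ball_subset_of_step hκ0 hκ hz hzz hu)) _).trans hQ)
  exact (ENNReal.rpow_le_rpow_iff hp).1 h3

/-- A single v in the ball is good for u and u' at once: the increment from u' plays the role of `h`
in `exists_step`. -/
theorem edist_le_of_common_ball (hf : StronglyMeasurable f) {κ p τ : ℝ} (hκ0 : 0 < κ) (hκ : κ ≤ 1)
    (hp : 0 < p) (hτ : 0 < τ)
    {z u u' : Euc d} (hz : 4 * τ ≤ κ * bdryDist Ω z)
    (hu : u ∈ Metric.ball z τ) (hu' : u' ∈ Metric.ball z τ) {Q : ℝ≥0∞}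
    (hQ : avgFactor d τ * localOsc Ω κ p f u ≤ Q ^ p)
    (hQ' : avgFactor d τ * localOsc Ω κ p f u' ≤ Q ^ p) :
    edist (f u) (f u') ≤ 2 * Q := by
  have hm : Measurable fun v => edist (f u') (f v) ^ p :=
    (measurable_uncurry_edist_rpow hf p).comp measurable_prodMk_left
  have hzz : dist z z ≤ τ := by rw [dist_self]; exact hτ.le
  obtain ⟨v, hv, h1, h2⟩ := exists_step hf hκ0 hκ hp hτ hz hzz hu hm hQ
  have h3 : edist (f u') (f v) ^ p ≤ Q ^ p := h2.trans ((mul_le_mul_right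
    (lintegral_mono_set (ball_subset_of_step hκ0 hκ hz hzz hu')) _).trans hQ')
  have h4 := (ENNReal.rpow_le_rpow_iff hp).1 h3
  calc edist (f u) (f u') ≤ edist (f u) (f v) + edist (f u') (f v) := edist_triangle_right _ _ _
    _ ≤ Q + Q := add_le_add h1 h4
    _ = 2 * Q := (two_mul Q).symm

/-- Moving along a chain of balls of radius `τ` while controlling the increments of `f`. -/
theorem exists_path (hf : StronglyMeasurable f) {κ p τ : ℝ} (hκ0 : 0 < κ) (hκ : κ ≤ 1)
    (hp : 0 < p) (hτ : 0 < τ) {z : ℕ → Euc d} {N : ℕ}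
    (hz : ∀ i ≤ N, 4 * τ ≤ κ * bdryDist Ω (z i)) (hstep : ∀ i < N, dist (z i) (z (i + 1)) ≤ τ)
    {E : Set (Euc d)} (hE : ∀ i ≤ N, Metric.ball (z i) τ ⊆ E) {u : Euc d}
    (hu : u ∈ Metric.ball (z 0) τ) {Q : ℝ≥0∞}
    (hQ : avgFactor d τ * localOsc Ω κ p f u ≤ Q ^ p)
    (hI : avgFactor d τ * (avgFactor d τ * ∫⁻ w in E, localOsc Ω κ p f w) ≤ Q ^ p) :
    ∀ n ≤ N, ∃ v ∈ Metric.ball (z n) τ, edist (f u) (f v) ≤ n * Q ∧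
      avgFactor d τ * localOsc Ω κ p f v ≤ Q ^ p := by
  intro n
  induction n with
  | zero => exact fun _ => ⟨u, hu, by simp, hQ⟩
  | succ n ih =>
    intro hn
    obtain ⟨v, hv, h1, h2⟩ := ih (by lia)
    obtain ⟨w, hw, h3, h4⟩ := exists_step hf hκ0 hκ hp hτ (hz n (by lia)) (hstep n (by lia)) hv
      (measurable_localOsc (Ω := Ω) hf κ p) h2
    refine ⟨w, hw, ?_, ?_⟩
    · calc edist (f u) (f w) ≤ edist (f u) (f v) + edist (f v) (f w) := edist_triangle _ _ _
        _ ≤ n * Q + Q := add_le_add h1 h3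
        _ = (n + 1 : ℕ) * Q := by push_cast; ring
    -- The bound on G at the new point comes afresh from the integral over E, not from the previous
    -- point, so Q does not grow along the chain.
    · exact (mul_le_mul_right (h4.trans (mul_le_mul_right
        (lintegral_mono_set (hE (n + 1) hn)) _)) _).trans hI

end Chains

/-! ### Travelling along the curves of a uniform domain -/

section Uniform

variable {d : ℕ} {Ω : Set (Euc d)} {F : Type*} [NormedAddCommGroup F] {f : Euc d → F}

/-- The curve condition of a uniform domain with constant `K`, for 1-Lipschitz curves. -/
def UniformWith (K : ℝ) (Ω : Set (Euc d)) : Prop :=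
  ∀ x ∈ Ω, ∀ y ∈ Ω, ∃ (l : ℝ) (γ : ℝ → Euc d), 0 ≤ l ∧
    (∀ s ∈ Icc 0 l, ∀ t ∈ Icc 0 l, s ≤ t → dist (γ s) (γ t) ≤ t - s) ∧ MapsTo γ (Icc 0 l) Ω ∧
    γ 0 = x ∧ γ l = y ∧ l ≤ K * dist x y ∧
    ∀ t ∈ Icc 0 l, min (dist (γ t) x) (dist (γ t) y) ≤ K * bdryDist Ω (γ t)

theorem IsUniformDomain.exists_uniformWith (h : IsUniformDomain Ω) :
    ∃ K : ℝ, 1 ≤ K ∧ UniformWith K Ω := by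
  obtain ⟨K, hK, hcurve⟩ := h.exists_curve
  refine ⟨K, hK, fun x hx y hy => ?_⟩
  obtain ⟨l, γ, hl, hγ, hmap, h0, h1, hlen, hcig⟩ := hcurve x hx y hy
  refine ⟨l, γ, hl, fun s hs t ht hst => ?_, hmap, h0, h1, hlen, fun t ht => ?_⟩
  · have := eVariationOn.edist_le γ (s := Icc 0 l ∩ Icc s t) ⟨hs, left_mem_Icc.2 hst⟩
      ⟨ht, right_mem_Icc.2 hst⟩
    rw [hγ hs ht, edist_dist, NNReal.coe_one, one_mul] at this
    exact (ENNReal.ofReal_le_ofReal_iff (sub_nonneg.2 hst)).1 this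
  · have := hcig t ht
    rw [div_mul_eq_mul_div, one_mul, div_le_iff₀ (by linarith)] at this
    linarith

/-- In a uniform domain, `f` can be followed from `u` to the vicinity of `w` in a number of steps
that only depends on the uniformity constant, if both points are far from the boundary in
comparison with their distance. -/
theorem UniformWith.exists_travel {K : ℝ} (hU : UniformWith K Ω) (hK : 1 ≤ K) (hΩ : IsOpen Ω)
    (hf : StronglyMeasurable f) {κ p r : ℝ} (hκ0 : 0 < κ) (hκ : κ ≤ 1) (hp : 0 < p) (hr : 0 < r)
    {u w : Euc d} (hu : u ∈ Ω) (hw : w ∈ Ω) (hru : r ≤ 4 * K * bdryDist Ω u)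
    (hrw : r ≤ 4 * K * bdryDist Ω w) (huw : dist u w ≤ 5 * r) {N : ℕ}
    (hN : 160 * K ^ 3 / κ ≤ N) {Q : ℝ≥0∞}
    (hQ : avgFactor d (κ * r / (32 * K ^ 2)) * localOsc Ω κ p f u ≤ Q ^ p)
    (hI : avgFactor d (κ * r / (32 * K ^ 2)) * (avgFactor d (κ * r / (32 * K ^ 2)) *
      ∫⁻ z in {z | z ∈ Ω ∧ dist z u ≤ 6 * K * r ∧ r ≤ 16 * K ^ 2 * bdryDist Ω z},
        localOsc Ω κ p f z) ≤ Q ^ p) :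
    ∃ v ∈ Metric.ball w (κ * r / (32 * K ^ 2)), edist (f u) (f v) ≤ N * Q ∧
      avgFactor d (κ * r / (32 * K ^ 2)) * localOsc Ω κ p f v ≤ Q ^ p := by
  obtain ⟨l, γ, hl, hlip, hmap, h0, h1, hlen, hcig⟩ := hU u hu w hw
  have hK2 : 0 < K ^ 2 := by positivity
  set τ := κ * r / (32 * K ^ 2) with hτdef
  have hτ : 0 < τ := by positivity
  have hτr : 32 * K ^ 2 * τ = κ * r := by rw [hτdef]; field_simp
  have hNpos : (0 : ℝ) < N := lt_of_lt_of_le (by positivity) hN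
  -- The curve has length at most 5Kr, and 160 = 5 · 32: cutting it into N pieces gives steps of
  -- length at most κr/(32K²) = τ.
  have hlN : l / N ≤ τ := by
    rw [div_le_iff₀ hNpos]
    have h2 : 160 * K ^ 3 ≤ N * κ := (div_le_iff₀ hκ0).1 hN
    have h3 : l ≤ K * (5 * r) := hlen.trans (mul_le_mul_of_nonneg_left huw (by linarith))
    have h4 : 32 * K ^ 2 * (K * (5 * r)) ≤ 32 * K ^ 2 * (τ * N) := by
      calc 32 * K ^ 2 * (K * (5 * r)) = 160 * K ^ 3 * r := by ring
        _ ≤ N * κ * r := mul_le_mul_of_nonneg_right h2 hr.le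
        _ = 32 * K ^ 2 * τ * N := by rw [hτr]; ring
        _ = 32 * K ^ 2 * (τ * N) := by ring
    exact h3.trans (le_of_mul_le_mul_left h4 (by positivity))
  have hmem : ∀ i ≤ N, (i : ℝ) * (l / N) ∈ Icc 0 l := fun i hi => by
    have hi' : (i : ℝ) ≤ N := by exact_mod_cast hi
    refine ⟨by positivity, ?_⟩
    rw [mul_div_assoc', div_le_iff₀ hNpos]
    nlinarith
  -- If u is the end point with |γ(t) - u| ≤ Kδ(γ(t)), then δ(u) ≤ 2Kδ(γ(t)), so r ≤ 4Kδ(u) ≤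
  -- 8K²δ(γ(t)); the same works for w.
  have hδ : ∀ t ∈ Icc 0 l, r ≤ 8 * K ^ 2 * bdryDist Ω (γ t) := fun t ht => by
    have hb1 := bdryDist_le_add_dist (Ω := Ω) u (γ t)
    have hb2 := bdryDist_le_add_dist (Ω := Ω) w (γ t)
    rw [dist_comm] at hb1 hb2
    have hn := bdryDist_nonneg (Ω := Ω) (γ t)
    rcases min_le_iff.1 (hcig t ht) with h | h
    · nlinarith [mul_nonneg (by linarith : (0 : ℝ) ≤ K) hn, mul_nonneg hK2.le hn]
    · nlinarith [mul_nonneg (by linarith : (0 : ℝ) ≤ K) hn, mul_nonneg hK2.le hn]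
  have hend : (N : ℝ) * (l / N) = l := mul_div_cancel₀ _ hNpos.ne'
  have hpath := exists_path (Ω := Ω) hf hκ0 hκ hp hτ (z := fun i : ℕ => γ (i * (l / N))) (N := N)
    (E := {z | z ∈ Ω ∧ dist z u ≤ 6 * K * r ∧ r ≤ 16 * K ^ 2 * bdryDist Ω z})
    (u := u) (Q := Q) ?_ ?_ ?_ ?_ hQ hI N le_rfl
  · simpa only [hend, h1] using hpath
  -- The 32 in τ is 4 · 8: the factor 4 required for a step times the 8 of `hδ`.
  · intro i hi
    have := hδ _ (hmem i hi)
    have h5 : 32 * K ^ 2 * τ ≤ 8 * K ^ 2 * (κ * bdryDist Ω (γ (i * (l / N)))) := by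
      rw [hτr]; nlinarith
    nlinarith
  · intro i hi
    refine (hlip _ (hmem i hi.le) _ (hmem (i + 1) hi) ?_).trans ?_
    · push_cast
      nlinarith [div_nonneg hl hNpos.le]
    · push_cast
      linarith
  -- Leaving the curve by less than τ costs at most Kr in the distance to u, whence 6K, and at most
  -- r/4 in 8K²δ, which the passage from 8K² to 16K² absorbs.
  · intro i hi z hz
    have hm := hmem i hi
    set y := γ (i * (l / N)) with hy
    have hyΩ : y ∈ Ω := hmap hm
    rw [Metric.mem_ball] at hz
    have h6 := hδ _ hm
    rw [← hy] at h6
    have hκr : κ * r ≤ r := mul_le_of_le_one_left hr.le hκ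
    have hb := bdryDist_le_add_dist (Ω := Ω) y z
    rw [dist_comm] at hb
    have hyτ : τ < bdryDist Ω y := by
      have : 32 * K ^ 2 * τ < 32 * K ^ 2 * bdryDist Ω y := by
        rw [hτr]; nlinarith
      exact lt_of_mul_lt_mul_left this (by positivity)
    refine ⟨ball_bdryDist_subset hΩ hyΩ (Metric.mem_ball.2 (hz.trans hyτ)), ?_, ?_⟩
    · have hd1 := hlip 0 (left_mem_Icc.2 hl) _ hm hm.1
      rw [h0, ← hy, dist_comm, sub_zero] at hd1
      have hd2 := dist_triangle z y u
      have hτ' : τ ≤ K * r := by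
        have h7 : 1 ≤ K ^ 2 := one_le_pow₀ hK
        have h8 : τ ≤ 32 * K ^ 2 * τ := by nlinarith
        nlinarith
      have h9 : l ≤ K * (5 * r) := hlen.trans (mul_le_mul_of_nonneg_left huw (by linarith))
      linarith [hm.2]
    · nlinarith
  · simp only [Nat.cast_zero, zero_mul, h0]
    exact Metric.mem_ball_self hτ

/-- In a uniform domain there are corkscrew points at every scale. -/
theorem UniformWith.exists_corkscrew {K : ℝ} (hU : UniformWith K Ω) {x y : Euc d} (hx : x ∈ Ω)
    (hy : y ∈ Ω) {ρ : ℝ} (hρ : 0 ≤ ρ) (hρ2 : 2 * ρ ≤ dist x y) :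
    ∃ w ∈ Ω, dist w x = ρ ∧ ρ ≤ K * bdryDist Ω w := by
  obtain ⟨l, γ, hl, hlip, hmap, h0, h1, hlen, hcig⟩ := hU x hx y hy
  have hcont : ContinuousOn γ (Icc 0 l) := by
    refine (LipschitzOnWith.of_dist_le_mul (K := 1) fun s hs t ht => ?_).continuousOn
    rw [NNReal.coe_one, one_mul, Real.dist_eq]
    rcases le_total s t with h | h
    · rw [abs_sub_comm]; exact (hlip s hs t ht h).trans (le_abs_self _)
    · rw [dist_comm]; exact (hlip t ht s hs h).trans (le_abs_self _)
  -- The corkscrew point is where the curve crosses the sphere of radius ρ about x. Since 2ρ ≤ |x -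
  -- y|, it is no closer to y than to x, so the minimum in the curve condition is ρ.
  have := intermediate_value_Icc hl
    (by fun_prop : ContinuousOn (fun t => dist (γ t) x) (Icc 0 l))
  obtain ⟨t, ht, hts⟩ := this (show ρ ∈ _ by
    rw [h0, h1, dist_self, dist_comm y x]; exact ⟨hρ, by linarith⟩)
  refine ⟨γ t, hmap ht, hts, ?_⟩
  have h2 := hcig t ht
  have h3 := dist_triangle_left x y (γ t)
  have hts' : dist (γ t) x = ρ := hts
  rw [hts'] at h2 h3
  rwa [min_eq_left (by linarith)] at h2

end Uniform

/-! ### Pointwise bound for increments between distant points -/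

section Pointwise

variable {d : ℕ} {Ω : Set (Euc d)} {F : Type*} [NormedAddCommGroup F] {f : Euc d → F}

/-- The points of `Ω` whose distances to the boundary and, at most, to `x` are comparable to `ρ`. -/
def scaleSet (A : ℝ) (Ω : Set (Euc d)) (x : Euc d) (ρ : ℝ) : Set (Euc d) :=
  {u | u ∈ Ω ∧ dist u x ≤ A * ρ ∧ ρ ≤ A * bdryDist Ω u ∧ bdryDist Ω u ≤ A * ρ}

/-- The normalized size of `G` near `x` at the scale `ρ`. -/
noncomputable def scaleAvg (A : ℝ) (Ω : Set (Euc d)) (G : Euc d → ℝ≥0∞) (x : Euc d) (ρ : ℝ) :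
    ℝ≥0∞ :=
  ENNReal.ofReal (ρ ^ d)⁻¹ * (scaleSet A Ω x ρ).indicator G x +
    ENNReal.ofReal (ρ ^ d)⁻¹ ^ 2 * ∫⁻ u in scaleSet A Ω x ρ, G u

/-- For z in the left set, |z - x| ≤ 6Kρ + 2ρ ≤ 16K²ρ. The summand 2/κ of A comes from δ(x) ≤
(2/κ)ρ, which is needed to bound δ(z) from above. -/
theorem subset_scaleSet {K κ A ρ : ℝ} (hK : 1 ≤ K) (hκ0 : 0 < κ) (hA : 16 * K ^ 2 + 2 / κ ≤ A)
    (hρ : 0 < ρ) {x u : Euc d} (hux : dist u x ≤ 2 * ρ) (hx : κ * bdryDist Ω x ≤ 2 * ρ) :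
    {z | z ∈ Ω ∧ dist z u ≤ 6 * K * ρ ∧ ρ ≤ 16 * K ^ 2 * bdryDist Ω z} ⊆ scaleSet A Ω x ρ := by
  rintro z ⟨hz, hzu, hzδ⟩
  have h2κ : 0 < 2 / κ := by positivity
  have h1 := dist_triangle z u x
  have h2 := bdryDist_le_add_dist (Ω := Ω) z x
  have h3 : bdryDist Ω x ≤ 2 / κ * ρ := by
    rw [div_mul_eq_mul_div, le_div_iff₀ hκ0]; linarith
  have h4 : 8 * K * ρ ≤ 16 * K ^ 2 * ρ := mul_le_mul_of_nonneg_right (by nlinarith) hρ.le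
  have h5 : (16 * K ^ 2 + 2 / κ) * ρ ≤ A * ρ := mul_le_mul_of_nonneg_right hA hρ.le
  have h6 : 0 ≤ 2 / κ * ρ := by positivity
  have h7 : ρ ≤ K * ρ := le_mul_of_one_le_left hρ.le hK
  refine ⟨hz, by nlinarith, hzδ.trans ?_, by nlinarith⟩
  exact mul_le_mul_of_nonneg_right (by linarith) (bdryDist_nonneg z)

theorem avgFactor_anti {τ τ' : ℝ} (h : τ ≤ τ') : avgFactor d τ' ≤ avgFactor d τ :=
  mul_le_mul_right (ENNReal.inv_le_inv.2 (measure_mono (Metric.ball_subset_ball h))) _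

theorem avgFactor_mul {c ρ : ℝ} (hc : 0 < c) (hρ : 0 < ρ) :
    avgFactor d (c * ρ) = avgFactor d c * ENNReal.ofReal (ρ ^ d)⁻¹ := by
  have hv := unitVol_pos d
  rw [avgFactor, avgFactor, volume_ball_eq_ofReal _ (mul_pos hc hρ), volume_ball_eq_ofReal _ hc,
    ← ENNReal.ofReal_inv_of_pos (by positivity), ← ENNReal.ofReal_inv_of_pos (by positivity),
    mul_assoc, ← ENNReal.ofReal_mul (by positivity)]
  congr 2
  rw [mul_pow, ← mul_inv]
  ring_nf

theorem avgFactor_ne_top {c : ℝ} (hc : 0 < c) : avgFactor d c ≠ ∞ :=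
  ENNReal.mul_ne_top (by norm_num)
    (ENNReal.inv_ne_top.2 (Metric.measure_ball_pos volume _ hc).ne')

/-- Climbing from `x` through corkscrew points at dyadic scales. -/
theorem UniformWith.exists_climb {K : ℝ} (hU : UniformWith K Ω) (hK : 1 ≤ K) (hΩ : IsOpen Ω)
    (hf : StronglyMeasurable f) {κ p r A : ℝ} (hκ0 : 0 < κ) (hκ : κ ≤ 1) (hp : 0 < p) (hr : 0 < r)
    (hA : 16 * K ^ 2 + 2 / κ ≤ A) {N : ℕ} (hN : 160 * K ^ 3 / κ ≤ N)
    {x : Euc d} (hx : x ∈ Ω) {w : ℕ → Euc d} (hwΩ : ∀ k, w k ∈ Ω)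
    (hwx : ∀ k, dist (w k) x = r / 2 ^ k) (hwδ : ∀ k, r / 2 ^ k ≤ K * bdryDist Ω (w k))
    {n : ℕ} (hn : r / 2 ^ n ≤ bdryDist Ω x) (hk : ∀ k ≤ n, κ * bdryDist Ω x ≤ 2 * (r / 2 ^ k))
    {Q : ℕ → ℝ≥0∞} (hQ : Antitone Q)
    (hQn : avgFactor d (κ * (r / 2 ^ n) / (32 * K ^ 2)) * localOsc Ω κ p f x ≤ Q n ^ p)
    (hI : ∀ k ≤ n, avgFactor d (κ * (r / 2 ^ k) / (32 * K ^ 2)) *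
      (avgFactor d (κ * (r / 2 ^ k) / (32 * K ^ 2)) *
        ∫⁻ z in scaleSet A Ω x (r / 2 ^ k), localOsc Ω κ p f z) ≤ Q k ^ p) :
    ∀ j ≤ n, ∃ v ∈ Metric.ball (w (n - j)) (κ * (r / 2 ^ (n - j)) / (32 * K ^ 2)),
      edist (f x) (f v) ≤ N * ∑ i ∈ Finset.range (j + 1), Q (n - i) ∧
      avgFactor d (κ * (r / 2 ^ (n - j)) / (32 * K ^ 2)) * localOsc Ω κ p f v ≤ Q (n - j) ^ p := by
  have hK2 : 1 ≤ K ^ 2 := one_le_pow₀ hK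
  have hδn : ∀ z, 0 ≤ bdryDist Ω z := bdryDist_nonneg
  intro j
  induction j with
  | zero =>
    intro _
    have hρ : 0 < r / 2 ^ n := by positivity
    simp only [Nat.sub_zero, zero_add, Finset.sum_range_one]
    have hKx : bdryDist Ω x ≤ K * bdryDist Ω x := le_mul_of_one_le_left (hδn x) hK
    refine hU.exists_travel hK hΩ hf hκ0 hκ hp hρ hx (hwΩ n) ?_ ?_ ?_ hN hQn
      ((mul_le_mul_right (mul_le_mul_right (lintegral_mono_set ?_) _) _).trans (hI n le_rfl))
    · linarith
    · linarith [hwδ n]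
    · rw [dist_comm, hwx n]; linarith
    · exact subset_scaleSet hK hκ0 hA hρ (by rw [dist_self]; positivity) (hk n le_rfl)
  | succ j ih =>
    intro hj
    obtain ⟨v, hv, h1, h2⟩ := ih (by lia)
    obtain ⟨k, rfl⟩ : ∃ k, n = k + (j + 1) := ⟨n - (j + 1), by lia⟩
    have e1 : k + (j + 1) - (j + 1) = k := by lia
    have e2 : k + (j + 1) - j = k + 1 := by lia
    rw [e1]
    rw [e2] at hv h2
    have hρ : 0 < r / 2 ^ k := by positivity
    have hhalf : r / 2 ^ (k + 1) = r / 2 ^ k / 2 := by rw [pow_succ, div_div]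
    have w1 := hwδ (k + 1)
    have w2 := hwx (k + 1)
    have w3 := hwδ k
    have w4 := hwx k
    rw [hhalf] at hv h2 w1 w2
    set ρ := r / 2 ^ k
    set τ := κ * (ρ / 2) / (32 * K ^ 2) with hτdef
    have hτ0 : 0 < τ := by positivity
    have hτr : 64 * K ^ 2 * τ = κ * ρ := by rw [hτdef]; field_simp; norm_num
    have hκρ : κ * ρ ≤ ρ := mul_le_of_le_one_left hρ.le hκ
    have hKτ : K * τ ≤ K ^ 2 * τ := mul_le_mul_of_nonneg_right (by nlinarith) hτ0.le
    have hτK : τ ≤ K * τ := le_mul_of_one_le_left hτ0.le hK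
    rw [Metric.mem_ball] at hv
    have hb := bdryDist_le_add_dist (Ω := Ω) (w (k + 1)) v
    rw [dist_comm] at hb
    have hKv : K * bdryDist Ω (w (k + 1)) ≤ K * bdryDist Ω v + K * τ := by
      rw [← mul_add]
      exact mul_le_mul_of_nonneg_left (by linarith) (by linarith)
    have hKv2 : K * τ < K * bdryDist Ω (w (k + 1)) := by linarith
    have hvΩ : v ∈ Ω := ball_bdryDist_subset hΩ (hwΩ (k + 1)) (Metric.mem_ball.2
      (hv.trans (lt_of_mul_lt_mul_left hKv2 (by linarith))))
    have hvx : dist v x ≤ ρ := (dist_triangle v (w (k + 1)) x).trans (by linarith)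
    -- The bound on G(v) known at scale ρ/2 remains valid at scale ρ: the averaging factor decreases
    -- with the radius, and Q at level k is at least Q at level k + 1.
    obtain ⟨v', hv', h3, h4⟩ := hU.exists_travel hK hΩ hf hκ0 hκ hp hρ hvΩ (hwΩ k)
      (by linarith) (by linarith)
      ((dist_triangle_right v (w k) x).trans (by linarith)) hN
      (((mul_le_mul_left (avgFactor_anti (by rw [hτdef]; gcongr; linarith)) _).trans h2).trans
        (ENNReal.rpow_le_rpow (hQ (Nat.le_succ k)) hp.le))
      ((mul_le_mul_right (mul_le_mul_right (lintegral_mono_set (subset_scaleSet hK hκ0 hA hρ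
        (by linarith) (hk k (by lia)))) _) _).trans (hI k (by lia)))
    refine ⟨v', hv', ?_, h4⟩
    rw [Finset.sum_range_succ, e1, mul_add]
    exact (edist_triangle _ _ _).trans (add_le_add h1 h3)

/-- Take the first n with r/2^n ≤ δ. For 0 < k ≤ n, minimality at k - 1 gives 2r/2^k > δ ≥ κδ, and k
= 0 is the hypothesis. -/
theorem exists_dyadic_stop {r δ κ : ℝ} (hδ : 0 < δ) (hκ : κ ≤ 1) (hr : κ * δ ≤ 2 * r) :
    ∃ n : ℕ, r / 2 ^ n ≤ δ ∧ ∀ k ≤ n, κ * δ ≤ 2 * (r / 2 ^ k) := by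
  classical
  have hex : ∃ n : ℕ, r / 2 ^ n ≤ δ := by
    obtain ⟨n, hn⟩ := pow_unbounded_of_one_lt (r / δ) (one_lt_two (α := ℝ))
    refine ⟨n, ?_⟩
    rw [div_lt_iff₀ hδ] at hn
    rw [div_le_iff₀ (by positivity)]
    linarith
  refine ⟨Nat.find hex, Nat.find_spec hex, fun k hk => ?_⟩
  rcases Nat.eq_zero_or_pos k with rfl | hk0
  · simpa using hr
  · obtain ⟨m, rfl⟩ : ∃ m, k = m + 1 := ⟨k - 1, by lia⟩
    have := Nat.find_min hex (m := m) (by lia)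
    rw [pow_succ, ← div_div]
    nlinarith [not_le.1 this]

/-- The increments of `f` between points that are far from each other are controlled by the local
oscillations at all smaller scales. -/
theorem UniformWith.edist_rpow_le {K : ℝ} (hU : UniformWith K Ω) (hK : 1 ≤ K) (hΩ : IsOpen Ω)
    (hF : (frontier Ω).Nonempty) {κ p A t : ℝ} (hκ0 : 0 < κ) (hκ : κ ≤ 1) (hp : 0 < p)
    (ht : 0 < t) (hA : 16 * K ^ 2 + 2 / κ ≤ A) :
    ∃ C : ℝ≥0∞, C ≠ ∞ ∧ ∀ f : Euc d → F, StronglyMeasurable f → ∀ x ∈ Ω, ∀ y ∈ Ω, x ≠ y →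
      κ * bdryDist Ω x ≤ dist x y → κ * bdryDist Ω y ≤ dist x y →
      edist (f x) (f y) ^ p ≤ C * ∑' k : ℕ, ((2 : ℝ≥0∞) ^ (t * p)) ^ k *
        (scaleAvg A Ω (localOsc Ω κ p f) x (dist x y / 2 / 2 ^ k) +
          scaleAvg A Ω (localOsc Ω κ p f) y (dist x y / 2 / 2 ^ k)) := by
  obtain ⟨N, hN⟩ := exists_nat_ge (160 * K ^ 3 / κ)
  have hK2 : 1 ≤ K ^ 2 := one_le_pow₀ hK
  set q : ℝ≥0∞ := 2 ^ (-t) with hq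
  have hq1 : q < 1 := ENNReal.rpow_lt_one_of_one_lt_of_neg (by norm_num) (by linarith)
  set L : ℝ≥0∞ := (1 - q)⁻¹ with hL
  have hLt : L ≠ ∞ := ENNReal.inv_ne_top.2 (tsub_pos_of_lt hq1).ne'
  set c₂ := avgFactor d (κ / (32 * K ^ 2)) with hc₂
  have hc₂t : c₂ ≠ ∞ := avgFactor_ne_top (by positivity)
  -- Climb from x, crossing, meeting in a common ball, and climb from y.
  set D : ℝ≥0∞ := N * L + N + 2 + N * L with hD
  have hDt : D ≠ ∞ := by
    simp [hD, ENNReal.mul_ne_top (ENNReal.natCast_ne_top N) hLt]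
  refine ⟨D ^ p * (c₂ + c₂ ^ 2), ENNReal.mul_ne_top (ENNReal.rpow_ne_top_of_nonneg hp.le hDt)
    (ENNReal.add_ne_top.2 ⟨hc₂t, ENNReal.pow_ne_top hc₂t⟩), fun f hf x hx y hy hxy hxR hyR => ?_⟩
  have hR : 0 < dist x y := dist_pos.2 hxy
  set r := dist x y / 2 with hr
  have hr0 : 0 < r := by positivity
  set G := localOsc Ω κ p f with hG
  set a : ℝ≥0∞ := 2 ^ (t * p) with ha
  set S := ∑' k : ℕ, a ^ k * (scaleAvg A Ω G x (r / 2 ^ k) + scaleAvg A Ω G y (r / 2 ^ k)) with hS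
  -- The increment allowed at level k is q^k P. Each term of S is at most S and q^p a = 1, so level
  -- k of the scale averages is at most (q^p)^k S. Hence this one P meets the requirements of all
  -- levels, and the increments sum geometrically to at most N L P.
  set P := ((c₂ + c₂ ^ 2) * S) ^ (1 / p) with hP
  have hPp : P ^ p = (c₂ + c₂ ^ 2) * S := by
    rw [hP, ← ENNReal.rpow_mul, one_div_mul_cancel hp.ne', ENNReal.rpow_one]
  have hqa : q ^ p * a = 1 := by
    rw [hq, ha, ← ENNReal.rpow_mul, ← ENNReal.rpow_add _ _ (by norm_num) (by norm_num),
      neg_mul, neg_add_cancel, ENNReal.rpow_zero]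
  have hQp : ∀ k : ℕ, (q ^ k * P) ^ p = (q ^ p) ^ k * ((c₂ + c₂ ^ 2) * S) := fun k => by
    rw [ENNReal.mul_rpow_of_nonneg _ _ hp.le, hPp, ← ENNReal.rpow_natCast q k,
      ← ENNReal.rpow_natCast (q ^ p) k, ← ENNReal.rpow_mul q, ← ENNReal.rpow_mul q,
      mul_comm (k : ℝ)]
  have hterm : ∀ k : ℕ, scaleAvg A Ω G x (r / 2 ^ k) + scaleAvg A Ω G y (r / 2 ^ k) ≤
      (q ^ p) ^ k * S := fun k => by
    have h1 := mul_le_mul_right (ENNReal.le_tsum (f := fun k : ℕ => a ^ k *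
      (scaleAvg A Ω G x (r / 2 ^ k) + scaleAvg A Ω G y (r / 2 ^ k))) k) ((q ^ p) ^ k)
    rwa [← mul_assoc, ← mul_pow, hqa, one_pow, one_mul] at h1
  have havg : ∀ k : ℕ, avgFactor d (κ * (r / 2 ^ k) / (32 * K ^ 2)) =
      c₂ * ENNReal.ofReal ((r / 2 ^ k) ^ d)⁻¹ := fun k => by
    rw [hc₂, ← avgFactor_mul (by positivity) (by positivity)]
    congr 1; ring
  have hanti : Antitone fun k : ℕ => q ^ k * P :=
    fun i j hij => mul_le_mul_left (pow_le_pow_right_of_le_one' hq1.le hij) _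
  have hsum : ∀ n, (N : ℝ≥0∞) * ∑ i ∈ Finset.range (n + 1), q ^ (n - i) * P ≤ N * L * P :=
    fun n => by
    rw [Finset.sum_flip (fun i => q ^ i * P), ← Finset.sum_mul, ← mul_assoc]
    refine mul_le_mul_left (mul_le_mul_right ?_ _) _
    rw [hL, ← ENNReal.tsum_geometric]
    exact ENNReal.sum_le_tsum _
  have hIx : ∀ z : Euc d, (∀ k : ℕ, scaleAvg A Ω G z (r / 2 ^ k) ≤ (q ^ p) ^ k * S) → ∀ k : ℕ,
      avgFactor d (κ * (r / 2 ^ k) / (32 * K ^ 2)) *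
        (avgFactor d (κ * (r / 2 ^ k) / (32 * K ^ 2)) *
          ∫⁻ u in scaleSet A Ω z (r / 2 ^ k), G u) ≤ (q ^ k * P) ^ p := fun z hz k => by
    rw [hQp, havg]
    calc _ = c₂ ^ 2 * (ENNReal.ofReal ((r / 2 ^ k) ^ d)⁻¹ ^ 2 *
          ∫⁻ u in scaleSet A Ω z (r / 2 ^ k), G u) := by ring
      _ ≤ (c₂ + c₂ ^ 2) * ((q ^ p) ^ k * S) :=
          mul_le_mul' le_add_self (le_add_self.trans (hz k))
      _ = _ := by ring
  have hside : ∀ z ∈ Ω, ∀ z' ∈ Ω, dist z z' = dist x y → κ * bdryDist Ω z ≤ dist x y →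
      (∀ k : ℕ, scaleAvg A Ω G z (r / 2 ^ k) ≤ (q ^ p) ^ k * S) →
      ∃ w ∈ Ω, dist w z = r ∧ r ≤ K * bdryDist Ω w ∧
      ∃ v ∈ Metric.ball w (κ * r / (32 * K ^ 2)), edist (f z) (f v) ≤ N * L * P ∧
        avgFactor d (κ * r / (32 * K ^ 2)) * G v ≤ P ^ p := by
    intro z hz z' hz' hzz hzR hzS
    have hcork : ∀ k : ℕ, ∃ w ∈ Ω, dist w z = r / 2 ^ k ∧ r / 2 ^ k ≤ K * bdryDist Ω w := fun k => by
      refine hU.exists_corkscrew hz hz' (by positivity) ?_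
      have : r / 2 ^ k ≤ r := div_le_self hr0.le (one_le_pow₀ one_le_two)
      rw [hzz]; linarith
    choose w hwΩ hwz hwδ using hcork
    have hδz := bdryDist_pos hΩ hF hz
    obtain ⟨n, hn, hnk⟩ := exists_dyadic_stop (r := r) hδz hκ (by linarith)
    -- The starting point is prescribed, not selected, so G(z) has to be bounded directly. This is
    -- the purpose of the indicator term in `scaleAvg`, which is active at the stopping level n.
    have hzmem : z ∈ scaleSet A Ω z (r / 2 ^ n) := by
      have h2κ : 0 < 2 / κ := by positivity
      have hρ : 0 < r / 2 ^ n := by positivity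
      refine ⟨hz, by rw [dist_self]; exact mul_nonneg (by linarith) hρ.le, ?_, ?_⟩
      · nlinarith
      · have h3 : bdryDist Ω z ≤ 2 / κ * (r / 2 ^ n) := by
          rw [div_mul_eq_mul_div, le_div_iff₀ hκ0]; linarith [hnk n le_rfl]
        exact h3.trans (mul_le_mul_of_nonneg_right (by linarith) hρ.le)
    have hQn : avgFactor d (κ * (r / 2 ^ n) / (32 * K ^ 2)) * G z ≤ (q ^ n * P) ^ p := by
      rw [hQp, havg]
      calc _ = c₂ * (ENNReal.ofReal ((r / 2 ^ n) ^ d)⁻¹ * (scaleSet A Ω z (r / 2 ^ n)).indicator G z)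
            := by rw [indicator_of_mem hzmem]; ring
        _ ≤ (c₂ + c₂ ^ 2) * ((q ^ p) ^ n * S) :=
            mul_le_mul' le_self_add (le_self_add.trans (hzS n))
        _ = _ := by ring
    obtain ⟨v, hv, h1, h2⟩ := hU.exists_climb hK hΩ hf hκ0 hκ hp hr0 hA hN hz hwΩ hwz hwδ hn hnk
      hanti hQn (fun k _ => hIx z hzS k) n le_rfl
    simp only [Nat.sub_self, pow_zero, div_one, one_mul] at hv h2
    have hw1 := hwz 0
    have hw2 := hwδ 0
    simp only [pow_zero, div_one] at hw1 hw2
    exact ⟨w 0, hwΩ 0, hw1, hw2, v, hv, h1.trans (hsum n), h2⟩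
  obtain ⟨w, hwΩ, hwx, hwδ, v, hv, hv1, hv2⟩ := hside x hx y hy rfl hxR
    fun k => le_self_add.trans (hterm k)
  obtain ⟨w', hwΩ', hwy, hwδ', v', hv', hv1', hv2'⟩ := hside y hy x hx (dist_comm y x) hyR
    fun k => le_add_self.trans (hterm k)
  set τ := κ * r / (32 * K ^ 2) with hτdef
  have hτ0 : 0 < τ := by positivity
  have hτr : 32 * K ^ 2 * τ = κ * r := by rw [hτdef]; field_simp
  have hκr : κ * r ≤ r := mul_le_of_le_one_left hr0.le hκ
  have hKτ : K * τ ≤ K ^ 2 * τ := mul_le_mul_of_nonneg_right (by nlinarith) hτ0.le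
  have hτK : τ ≤ K * τ := le_mul_of_one_le_left hτ0.le hK
  rw [Metric.mem_ball] at hv
  have hb := bdryDist_le_add_dist (Ω := Ω) w v
  rw [dist_comm] at hb
  have hKv : K * bdryDist Ω w ≤ K * bdryDist Ω v + K * τ := by
    rw [← mul_add]
    exact mul_le_mul_of_nonneg_left (by linarith) (by linarith)
  have hvΩ : v ∈ Ω := ball_bdryDist_subset hΩ hwΩ (Metric.mem_ball.2
    (hv.trans (lt_of_mul_lt_mul_left (show K * τ < K * bdryDist Ω w by linarith) (by linarith))))
  have hvx : dist v x ≤ 2 * r := (dist_triangle v w x).trans (by linarith)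
  -- The path v, x, y, w' has legs at most 2r, 2r and r.
  have hvw' : dist v w' ≤ 5 * r := by
    have h1 := dist_triangle4 v x y w'
    rw [dist_comm y w'] at h1
    linarith
  have hI0 := hIx x (fun k => le_self_add.trans (hterm k)) 0
  simp only [pow_zero, div_one, one_mul] at hI0
  obtain ⟨u, hu, h3, h4⟩ := hU.exists_travel hK hΩ hf hκ0 hκ hp hr0 hvΩ hwΩ'
    (by linarith) (by linarith) hvw' hN hv2
    ((mul_le_mul_right (mul_le_mul_right (lintegral_mono_set (subset_scaleSet hK hκ0 hA hr0
      hvx (by linarith))) _) _).trans hI0)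
  have hmeet := edist_le_of_common_ball hf hκ0 hκ hp hτ0 (Ω := Ω) (z := w') (by
    have h5 : 32 * K ^ 2 * τ ≤ κ * (K * bdryDist Ω w') := by
      rw [hτr]; exact mul_le_mul_of_nonneg_left hwδ' hκ0.le
    have h6 : K * (32 * τ) ≤ K * (κ * bdryDist Ω w') := by nlinarith
    linarith [le_of_mul_le_mul_left h6 (by linarith)]) hu hv' h4 hv2'
  have hfin : edist (f x) (f y) ≤ D * P := by
    calc edist (f x) (f y) ≤ edist (f x) (f v) + edist (f v) (f u) + edist (f u) (f v') +
          edist (f v') (f y) := (edist_triangle _ (f v') _).trans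
            (add_le_add_left (edist_triangle4 _ _ _ _) _)
      _ ≤ N * L * P + N * P + 2 * P + N * L * P := by
          rw [edist_comm (f v') (f y)]
          gcongr
      _ = D * P := by rw [hD]; ring
  calc edist (f x) (f y) ^ p ≤ (D * P) ^ p := ENNReal.rpow_le_rpow hfin hp.le
    _ = D ^ p * (c₂ + c₂ ^ 2) * S := by rw [ENNReal.mul_rpow_of_nonneg _ _ hp.le, hPp, mul_assoc]

end Pointwise

/-! ### Integrals of the weights and the Assouad codimension -/

section Weights

variable {d : ℕ} {Ω : Set (Euc d)}

/-- A ray from x that misses the frontier stays in Ω by connectedness, contradicting boundedness. -/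
theorem exists_pos_smul_mem_frontier (hΩ : IsOpen Ω) (hbdd : Bornology.IsBounded Ω) {x v : Euc d}
    (hx : x ∈ Ω) (hv : v ≠ 0) : ∃ t : ℝ, 0 < t ∧ x + t • v ∈ frontier Ω := by
  by_contra! hcon
  have hpre : IsPreconnected ((fun t : ℝ => x + t • v) '' Ici 0) :=
    isPreconnected_Ici.image _ (by fun_prop)
  have hsub : (fun t : ℝ => x + t • v) '' Ici 0 ⊆ Ω := by
    refine hpre.subset_of_closure_inter_subset hΩ ⟨x, ⟨0, by simp, by simp⟩, hx⟩ ?_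
    rintro _ ⟨hy, t, ht, rfl⟩
    by_contra hyΩ
    rcases (show (0 : ℝ) ≤ t from ht).eq_or_lt with rfl | ht0
    · exact hyΩ (by simpa using hx)
    · exact hcon t ht0 (hΩ.frontier_eq ▸ ⟨hy, hyΩ⟩)
  obtain ⟨M, hM⟩ := hbdd.subset_ball x
  have hv0 : 0 < ‖v‖ := norm_pos_iff.2 hv
  have hmem := hM (hsub ⟨|M| / ‖v‖, by simp only [mem_Ici]; positivity, rfl⟩)
  rw [Metric.mem_ball, dist_eq_norm, add_sub_cancel_left, norm_smul, Real.norm_eq_abs,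
    abs_of_nonneg (by positivity), div_mul_cancel₀ _ hv0.ne'] at hmem
  exact absurd (le_abs_self M) (not_le.2 hmem)

/-- Two opposite rays from a point of Ω hit the frontier at different points. Positivity of the
diameter makes the range of radii in the codimension condition nonempty. -/
theorem ediam_frontier_pos (hd : 1 ≤ d) (hΩ : IsOpen Ω) (hne : Ω.Nonempty)
    (hbdd : Bornology.IsBounded Ω) : 0 < Metric.ediam (frontier Ω) := by
  have : Nonempty (Fin d) := ⟨⟨0, hd⟩⟩
  obtain ⟨v, hv⟩ := exists_ne (0 : Euc d)
  obtain ⟨x, hx⟩ := hne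
  obtain ⟨t, ht, h1⟩ := exists_pos_smul_mem_frontier hΩ hbdd hx hv
  obtain ⟨t', ht', h2⟩ := exists_pos_smul_mem_frontier hΩ hbdd hx (neg_ne_zero.2 hv)
  refine Metric.ediam_pos_iff.2 ⟨_, h1, _, h2, fun h => ?_⟩
  have h3 : (t + t') • v = 0 := by
    have := add_left_cancel h
    rw [smul_neg] at this
    rw [add_smul, this, neg_add_cancel]
  rcases smul_eq_zero.1 h3 with h | h
  · linarith
  · exact hv h

/-- The tR-neighbourhood of E contains a ball of radius tR, so t^d ≤ C t^q for all t in (0, 1),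
which fails for small t if q > d. -/
theorem AssouadCodimBound.le_dim {E : Set (Euc d)} {q : ℝ≥0} (h : AssouadCodimBound E q)
    (hne : E.Nonempty) (hE : 0 < Metric.ediam E) : (q : ℝ) ≤ d := by
  obtain ⟨C, hC, hb⟩ := h
  obtain ⟨x, hx⟩ := hne
  obtain ⟨R, hR0, hR⟩ := ENNReal.lt_iff_exists_real_btwn.1 hE
  have hR1 : 0 < R := ENNReal.ofReal_pos.1 hR.1
  by_contra! hq
  have key : ∀ t : ℝ, 0 < t → t < 1 → 1 ≤ C * t ^ ((q : ℝ) - d) := by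
    intro t ht ht1
    have h1 := hb x hx (t * R) R (by positivity) (by nlinarith) hR.2
    have h2 : volume (Metric.ball x (t * R)) ≤
        volume (Metric.cthickening (t * R) E ∩ Metric.ball x R) := measure_mono fun y hy =>
      ⟨Metric.mem_cthickening_of_dist_le y x _ _ hx (Metric.mem_ball.1 hy).le,
        Metric.ball_subset_ball (by nlinarith) hy⟩
    have h3 := h2.trans h1
    have hv := unitVol_pos d
    rw [volume_ball_eq_ofReal _ (by positivity), volume_ball_eq_ofReal _ hR1,
      mul_div_cancel_right₀ _ hR1.ne', ← ENNReal.ofReal_mul (by positivity),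
      ENNReal.ofReal_le_ofReal_iff (by positivity), mul_pow] at h3
    have h4 : t ^ d ≤ C * t ^ (q : ℝ) := by
      have h5 : t ^ d * (R ^ d * unitVol d) ≤ C * t ^ (q : ℝ) * (R ^ d * unitVol d) := by linarith
      exact le_of_mul_le_mul_right h5 (by positivity)
    rw [Real.rpow_sub ht, Real.rpow_natCast, mul_div_assoc', le_div_iff₀ (by positivity)]
    linarith
  have hpos : 0 < (q : ℝ) - d := by linarith
  have h2C : (1 / (2 * C)) ^ (1 / ((q : ℝ) - d)) < 1 :=
    Real.rpow_lt_one (by positivity) (by rw [div_lt_one (by positivity)]; linarith) (by positivity)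
  have := key _ (by positivity) h2C
  rw [← Real.rpow_mul (by positivity), one_div_mul_cancel hpos.ne', Real.rpow_one] at this
  have hC' : C * (1 / (2 * C)) = 1 / 2 := by field_simp
  linarith

theorem exists_mem_frontier_dist_eq (hbdd : Bornology.IsBounded Ω) (hF : (frontier Ω).Nonempty)
    (y : Euc d) : ∃ e ∈ frontier Ω, dist y e = bdryDist Ω y := by
  have hc : IsCompact (frontier Ω) :=
    Metric.isCompact_of_isClosed_isBounded isClosed_frontier
      (hbdd.closure.subset frontier_subset_closure)
  obtain ⟨e, he, h⟩ := hc.exists_infDist_eq_dist hF y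
  exact ⟨e, he, h.symm⟩

theorem measurable_bdryDist_rpow (β : ℝ) :
    Measurable fun y => ENNReal.ofReal (bdryDist Ω y ^ (-β)) :=
  (continuous_bdryDist.measurable.pow_const _).ennreal_ofReal

/-- The weight is integrable near boundary points, with the natural scaling. -/
theorem AssouadCodimBound.lintegral_le (hΩ : IsOpen Ω) (hbdd : Bornology.IsBounded Ω)
    (hF : (frontier Ω).Nonempty) {q : ℝ≥0} {β : ℝ} (hβ0 : 0 ≤ β) (hβ : β < q)
    (h : AssouadCodimBound (frontier Ω) q) :
    ∃ C : ℝ≥0∞, C ≠ ∞ ∧ ∀ ω ∈ frontier Ω, ∀ R : ℝ, 0 < R →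
      ENNReal.ofReal R < Metric.ediam (frontier Ω) →
      ∫⁻ y in Ω ∩ Metric.ball ω R, ENNReal.ofReal (bdryDist Ω y ^ (-β)) ≤
        C * ENNReal.ofReal (R ^ d * R ^ (-β)) := by
  obtain ⟨C, hC, hb⟩ := h
  have hv := unitVol_pos d
  set g : ℝ := (1 / 2) ^ ((q : ℝ) - β) with hg
  have hg0 : 0 < g := by positivity
  have hg1 : g < 1 := Real.rpow_lt_one (by norm_num) (by norm_num) (by linarith)
  refine ⟨ENNReal.ofReal (C * unitVol d * 2 ^ β) * (1 - ENNReal.ofReal g)⁻¹,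
    ENNReal.mul_ne_top ENNReal.ofReal_ne_top (ENNReal.inv_ne_top.2
      (tsub_pos_of_lt (ENNReal.ofReal_lt_one.2 hg1)).ne'), fun ω hω R hR hRE => ?_⟩
  -- Dyadic layers: if 2^(-n-1) R < δ(y) ≤ 2^(-n) R, then y lies in `T n` and its weight is at most
  -- `c n`. Against the volume bound the layers sum like a geometric series of ratio g = 2^(β-q).
  set T : ℕ → Set (Euc d) := fun n => Metric.cthickening ((1 / 2) ^ n * R) (frontier Ω) with hT
  have hTm : ∀ n, MeasurableSet (T n) := fun n => Metric.isClosed_cthickening.measurableSet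
  set c : ℕ → ℝ≥0∞ := fun n => ENNReal.ofReal (((1 / 2) ^ (n + 1) * R) ^ (-β)) with hc
  have hpt : ∀ y ∈ Ω ∩ Metric.ball ω R, ENNReal.ofReal (bdryDist Ω y ^ (-β)) ≤
      ∑' n, (T n).indicator (fun _ => c n) y := by
    rintro y ⟨hy, hyω⟩
    have hδ := bdryDist_pos hΩ hF hy
    have hδR : bdryDist Ω y ≤ R :=
      (Metric.infDist_le_dist_of_mem hω).trans (Metric.mem_ball.1 hyω).le
    obtain ⟨n, hn1, hn2⟩ := exists_nat_pow_near_of_lt_one (x := bdryDist Ω y / R) (y := 1 / 2)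
      (by positivity) ((div_le_one hR).2 hδR) (by norm_num) (by norm_num)
    rw [lt_div_iff₀ hR] at hn1
    rw [div_le_iff₀ hR] at hn2
    have hyT : y ∈ T n := by
      obtain ⟨e, he, hye⟩ := exists_mem_frontier_dist_eq hbdd hF y
      exact Metric.mem_cthickening_of_dist_le y e _ _ he (hye.trans_le hn2)
    refine le_trans ?_ (ENNReal.le_tsum n)
    rw [indicator_of_mem hyT]
    exact ENNReal.ofReal_le_ofReal
      (Real.rpow_le_rpow_of_nonpos (by positivity) hn1.le (by linarith))
  have hvol : ∀ n, volume (T n ∩ Metric.ball ω R) ≤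
      ENNReal.ofReal (C * ((1 / 2) ^ n) ^ (q : ℝ)) * volume (Metric.ball ω R) := by
    intro n
    -- The codimension condition demands r < R strictly, so the layer n = 0 uses C ≥ 1 instead.
    rcases Nat.eq_zero_or_pos n with rfl | hn
    · rw [pow_zero, Real.one_rpow, mul_one]
      exact (measure_mono inter_subset_right).trans
        (le_mul_of_one_le_left zero_le (ENNReal.one_le_ofReal.2 hC))
    · have := hb ω hω ((1 / 2) ^ n * R) R (by positivity)
        (mul_lt_of_lt_one_left hR (pow_lt_one₀ (by norm_num) (by norm_num) hn.ne')) hRE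
      rwa [mul_div_cancel_right₀ _ hR.ne'] at this
  have hterm : ∀ n, c n * volume (T n ∩ Metric.ball ω R) ≤
      ENNReal.ofReal (C * unitVol d * 2 ^ β) * ENNReal.ofReal (R ^ d * R ^ (-β)) *
        ENNReal.ofReal g ^ n := by
    intro n
    refine (mul_le_mul_right (hvol n) _).trans (le_of_eq ?_)
    rw [volume_ball_eq_ofReal _ hR, hc, ← ENNReal.ofReal_mul (by positivity),
      ← ENNReal.ofReal_mul (by positivity), ← ENNReal.ofReal_mul (by positivity),
      ← ENNReal.ofReal_pow hg0.le, ← ENNReal.ofReal_mul (by positivity)]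
    congr 1
    have e1 : (((1 : ℝ) / 2) ^ (n + 1) * R) ^ (-β) =
        (1 / 2) ^ (-(n * β)) * 2 ^ β * R ^ (-β) := by
      rw [Real.mul_rpow (by positivity) hR.le, ← Real.rpow_natCast, ← Real.rpow_mul (by norm_num)]
      congr 1
      have : (2 : ℝ) ^ β = (1 / 2) ^ (-β) := by
        rw [one_div, Real.inv_rpow (by norm_num), Real.rpow_neg (by norm_num), inv_inv]
      rw [this, ← Real.rpow_add (by norm_num)]
      congr 1
      push_cast; ring
    have e2 : g ^ n = (1 / 2) ^ (-(n * β)) * ((1 / 2) ^ n) ^ (q : ℝ) := by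
      rw [hg, ← Real.rpow_natCast, ← Real.rpow_natCast, ← Real.rpow_mul (by norm_num),
        ← Real.rpow_mul (by norm_num), ← Real.rpow_add (by norm_num)]
      congr 1
      ring
    rw [e1, e2]
    ring
  calc ∫⁻ y in Ω ∩ Metric.ball ω R, ENNReal.ofReal (bdryDist Ω y ^ (-β))
      ≤ ∫⁻ y in Ω ∩ Metric.ball ω R, ∑' n, (T n).indicator (fun _ => c n) y :=
        setLIntegral_mono' (hΩ.measurableSet.inter measurableSet_ball) hpt
    _ ≤ ∫⁻ y in Metric.ball ω R, ∑' n, (T n).indicator (fun _ => c n) y :=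
        lintegral_mono_set inter_subset_right
    _ = ∑' n, c n * volume (T n ∩ Metric.ball ω R) := by
        rw [lintegral_tsum fun n => (measurable_const.indicator (hTm n)).aemeasurable]
        refine tsum_congr fun n => ?_
        rw [lintegral_indicator_const (hTm n), Measure.restrict_apply (hTm n)]
    _ ≤ ∑' n, ENNReal.ofReal (C * unitVol d * 2 ^ β) * ENNReal.ofReal (R ^ d * R ^ (-β)) *
        ENNReal.ofReal g ^ n := ENNReal.tsum_le_tsum hterm
    _ = _ := by rw [ENNReal.tsum_mul_left, ENNReal.tsum_geometric]; ring

/-- The weight integral over a ball that is at least as large as the distance to the boundary. -/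
theorem exists_weight_bound (hd : 1 ≤ d) (hΩ : IsOpen Ω) (hne : Ω.Nonempty)
    (hbdd : Bornology.IsBounded Ω) {β : ℝ} (hβ0 : 0 ≤ β)
    (hβ : ENNReal.ofReal β < lowerAssouadCodim (frontier Ω)) :
    ∃ C : ℝ≥0∞, C ≠ ∞ ∧ ∀ u ∈ Ω, ∀ R : ℝ, bdryDist Ω u ≤ R →
      ∫⁻ y in Ω ∩ Metric.ball u R, ENNReal.ofReal (bdryDist Ω y ^ (-β)) ≤
        C * ENNReal.ofReal (R ^ d * R ^ (-β)) := by
  have hF := frontier_nonempty_of_isBounded hd hne hbdd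
  have hE := ediam_frontier_pos hd hΩ hne hbdd
  simp only [lowerAssouadCodim, lt_iSup_iff] at hβ
  obtain ⟨q, hq, hβq⟩ := hβ
  have hβq' : β < q := by
    rw [← ENNReal.ofReal_coe_nnreal] at hβq
    exact (ENNReal.ofReal_lt_ofReal_iff_of_nonneg hβ0).1 hβq
  have hqd := hq.le_dim hF hE
  obtain ⟨C, hC, hb⟩ := hq.lintegral_le hΩ hbdd hF hβ0 hβq'
  obtain ⟨R₀, -, hR₀⟩ := ENNReal.lt_iff_exists_real_btwn.1 hE
  have hR₀p : 0 < R₀ := ENNReal.ofReal_pos.1 hR₀.1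
  set w : Euc d → ℝ≥0∞ := fun y => ENNReal.ofReal (bdryDist Ω y ^ (-β)) with hw
  -- Finitely many balls at the compact frontier cover the points with δ < R₀/2; on the rest the
  -- weight is bounded.
  have hfin : ∫⁻ y in Ω, w y < ∞ := by
    have hc : IsCompact (frontier Ω) :=
      Metric.isCompact_of_isClosed_isBounded isClosed_frontier
        (hbdd.closure.subset frontier_subset_closure)
    obtain ⟨t, htF, htfin, htcov⟩ := hc.finite_cover_balls (half_pos hR₀p)
    set ν := (volume : Measure (Euc d)).withDensity w with hν
    have hνΩ : ν Ω = ∫⁻ y in Ω, w y := withDensity_apply _ hΩ.measurableSet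
    rw [← hνΩ]
    have hcover : Ω ⊆ (⋃ ω ∈ t, Ω ∩ Metric.ball ω R₀) ∪ {y | y ∈ Ω ∧ R₀ / 2 ≤ bdryDist Ω y} := by
      intro y hy
      rcases le_or_gt (R₀ / 2) (bdryDist Ω y) with h | h
      · exact Or.inr ⟨hy, h⟩
      · obtain ⟨e, he, hye⟩ := exists_mem_frontier_dist_eq hbdd hF y
        obtain ⟨ω, hω, heω⟩ := mem_iUnion₂.1 (htcov he)
        refine Or.inl (mem_iUnion₂.2 ⟨ω, hω, hy, ?_⟩)
        rw [Metric.mem_ball] at heω ⊢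
        linarith [dist_triangle y e ω]
    refine (measure_mono hcover).trans_lt ((measure_union_le _ _).trans_lt
      (ENNReal.add_lt_top.2 ⟨measure_biUnion_lt_top htfin fun ω hω => ?_, ?_⟩))
    · rw [hν, withDensity_apply _ (hΩ.measurableSet.inter measurableSet_ball)]
      exact (hb ω (htF hω) R₀ hR₀p hR₀.2).trans_lt
        (ENNReal.mul_lt_top hC.lt_top ENNReal.ofReal_lt_top)
    · have hm : MeasurableSet {y | y ∈ Ω ∧ R₀ / 2 ≤ bdryDist Ω y} :=
        hΩ.measurableSet.inter (measurableSet_le measurable_const continuous_bdryDist.measurable)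
      rw [hν, withDensity_apply _ hm]
      refine (setLIntegral_mono' (g := fun _ => ENNReal.ofReal ((R₀ / 2) ^ (-β))) hm
        fun y hy => ENNReal.ofReal_le_ofReal ?_).trans_lt ?_
      · exact Real.rpow_le_rpow_of_nonpos (by positivity) hy.2 (by linarith)
      · rw [setLIntegral_const]
        exact ENNReal.mul_lt_top ENNReal.ofReal_lt_top
          ((measure_mono fun y hy => hy.1).trans_lt hbdd.measure_lt_top)
  set c₀ : ℝ := (R₀ / 2) ^ ((d : ℝ) - β) with hc₀
  have hc₀p : 0 < c₀ := by positivity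
  refine ⟨C * ENNReal.ofReal (2 ^ d) + (∫⁻ y in Ω, w y) * ENNReal.ofReal c₀⁻¹,
    ENNReal.add_ne_top.2 ⟨ENNReal.mul_ne_top hC ENNReal.ofReal_ne_top,
      ENNReal.mul_ne_top hfin.ne ENNReal.ofReal_ne_top⟩, fun u hu R huR => ?_⟩
  have hR : 0 < R := (bdryDist_pos hΩ hF hu).trans_le huR
  rw [add_mul]
  -- Small balls are recentred at a nearest frontier point with doubled radius. For large R the
  -- total integral suffices, because β < q ≤ d keeps R^(d-β) above c₀.
  rcases le_or_gt (2 * R) R₀ with h2 | h2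
  · refine le_trans ?_ le_self_add
    obtain ⟨ω, hω, huω⟩ := exists_mem_frontier_dist_eq hbdd hF u
    have hsub : Ω ∩ Metric.ball u R ⊆ Ω ∩ Metric.ball ω (2 * R) :=
      inter_subset_inter_right _ (Metric.ball_subset_ball' (by linarith))
    refine (lintegral_mono_set hsub).trans ((hb ω hω (2 * R) (by linarith)
      ((ENNReal.ofReal_le_ofReal h2).trans_lt hR₀.2)).trans ?_)
    rw [mul_assoc, ← ENNReal.ofReal_mul (by positivity)]
    refine mul_le_mul_right (ENNReal.ofReal_le_ofReal ?_) _
    have e1 : (2 * R) ^ (-β) ≤ R ^ (-β) :=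
      Real.rpow_le_rpow_of_nonpos hR (by linarith) (by linarith)
    calc (2 * R) ^ d * (2 * R) ^ (-β) ≤ (2 * R) ^ d * R ^ (-β) := by gcongr
      _ = 2 ^ d * (R ^ d * R ^ (-β)) := by rw [mul_pow]; ring
  · refine le_trans (le_trans (lintegral_mono_set inter_subset_left) ?_) le_add_self
    rw [mul_assoc, ← ENNReal.ofReal_mul (by positivity)]
    refine le_mul_of_one_le_right zero_le (ENNReal.one_le_ofReal.2 ?_)
    rw [← Real.rpow_natCast R d, ← Real.rpow_add hR, ← sub_eq_add_neg, inv_mul_eq_div,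
      one_le_div hc₀p]
    exact Real.rpow_le_rpow (by positivity) (by linarith) (by linarith)

end Weights

/-! ### Integration against the kernel -/

section Reduction

variable {d : ℕ} {Ω : Set (Euc d)}

theorem gagliardoIntegrand_eq {𝕜 : Type*} [RCLike 𝕜] (s : ℝ) {p : ℝ} (hp : 0 ≤ p) (α β : ℝ)
    (f : Euc d → 𝕜) (x y : Euc d) :
    gagliardoIntegrand Ω s p α β f x y = edist (f x) (f y) ^ p *
      (ENNReal.ofReal (dist x y ^ (-((d : ℝ) + s * p))) *
        ENNReal.ofReal (bdryDist Ω y ^ (-β)) * ENNReal.ofReal (bdryDist Ω x ^ (-α))) := by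
  have hy := bdryDist_nonneg (Ω := Ω) y
  have hx := bdryDist_nonneg (Ω := Ω) x
  rw [gagliardoIntegrand, edist_dist, dist_eq_norm (f x), ENNReal.ofReal_rpow_of_nonneg
    (norm_nonneg _) hp, ← ENNReal.ofReal_mul (by positivity), ← ENNReal.ofReal_mul (by positivity),
    ← ENNReal.ofReal_mul (by positivity), Real.rpow_neg dist_nonneg]
  congr 1
  ring

/-- The integral of the local oscillations is controlled by the truncated seminorm. -/
theorem lintegral_localOsc_le {𝕜 : Type*} [RCLike 𝕜] (hΩ : IsOpen Ω) (hF : (frontier Ω).Nonempty)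
    {s p θ κ α β : ℝ} (hs : 0 < s) (hp : 0 < p) (hκ0 : 0 < κ) (hκθ : κ ≤ θ) (hκ : κ ≤ 1)
    (hβ : 0 ≤ β) (f : Euc d → 𝕜) :
    ∫⁻ u in Ω, localOsc Ω κ p f u *
        ENNReal.ofReal (bdryDist Ω u ^ (-((d : ℝ) + s * p) - α - β)) ≤
      ENNReal.ofReal (κ ^ ((d : ℝ) + s * p) * 2 ^ β) * truncatedSeminormPow Ω s p α β θ f := by
  have he : 0 < (d : ℝ) + s * p := by positivity
  set e := (d : ℝ) + s * p with hedef
  rw [truncatedSeminormPow, ← lintegral_const_mul' _ _ ENNReal.ofReal_ne_top]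
  refine setLIntegral_mono' hΩ.measurableSet fun u hu => ?_
  have hδ := bdryDist_pos hΩ hF hu
  rw [localOsc, ← lintegral_mul_const' _ _ ENNReal.ofReal_ne_top,
    ← lintegral_const_mul' _ _ ENNReal.ofReal_ne_top]
  refine le_trans (setLIntegral_mono' measurableSet_ball fun v hv => ?_)
    (lintegral_mono_set (Metric.ball_subset_ball (mul_le_mul_of_nonneg_right hκθ hδ.le)))
  -- On the diagonal the real power of the distance is 0, so the kernel bound fails there; the
  -- increment vanishes instead.
  rcases eq_or_ne u v with rfl | huv
  · rw [edist_self, ENNReal.zero_rpow_of_pos hp, zero_mul]; exact zero_le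
  have hvΩ := ball_mul_bdryDist_subset hΩ hκ hu hv
  have hδv := bdryDist_pos hΩ hF hvΩ
  have hdist : 0 < dist u v := dist_pos.2 huv
  rw [Metric.mem_ball, dist_comm] at hv
  have hb := bdryDist_le_add_dist (Ω := Ω) v u
  rw [dist_comm] at hb
  rw [gagliardoIntegrand_eq s hp.le, mul_left_comm, ← ENNReal.ofReal_mul (by positivity),
    ← ENNReal.ofReal_mul (by positivity), ← ENNReal.ofReal_mul (by positivity)]
  refine mul_le_mul_right (ENNReal.ofReal_le_ofReal ?_) _
  have h1 : bdryDist Ω u ^ (-e) ≤ κ ^ e * dist u v ^ (-e) := by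
    have h3 : (κ * bdryDist Ω u) ^ (-e) ≤ dist u v ^ (-e) :=
      Real.rpow_le_rpow_of_nonpos hdist hv.le (by linarith)
    rw [Real.mul_rpow hκ0.le hδ.le] at h3
    have h4 := mul_le_mul_of_nonneg_left h3 (show 0 ≤ κ ^ e by positivity)
    rwa [← mul_assoc, ← Real.rpow_add hκ0, add_neg_cancel, Real.rpow_zero, one_mul] at h4
  have h2 : bdryDist Ω u ^ (-β) ≤ 2 ^ β * bdryDist Ω v ^ (-β) := by
    have h3 : (2 * bdryDist Ω u) ^ (-β) ≤ bdryDist Ω v ^ (-β) :=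
      Real.rpow_le_rpow_of_nonpos hδv (by nlinarith) (by linarith)
    rw [Real.mul_rpow (by norm_num) hδ.le] at h3
    have h4 := mul_le_mul_of_nonneg_left h3 (show 0 ≤ (2 : ℝ) ^ β by positivity)
    rwa [← mul_assoc, ← Real.rpow_add (by norm_num), add_neg_cancel, Real.rpow_zero, one_mul] at h4
  calc bdryDist Ω u ^ (-e - α - β)
      = bdryDist Ω u ^ (-e) * bdryDist Ω u ^ (-β) * bdryDist Ω u ^ (-α) := by
        rw [← Real.rpow_add hδ, ← Real.rpow_add hδ]; ring_nf
    _ ≤ (κ ^ e * dist u v ^ (-e)) * (2 ^ β * bdryDist Ω v ^ (-β)) * bdryDist Ω u ^ (-α) := by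
        gcongr
    _ = _ := by ring

theorem mul_rpow_neg_le {B L β : ℝ} (hB : 1 ≤ B) (hL : 0 < L) (hβ : 0 ≤ β) :
    (B * L) ^ d * (B * L) ^ (-β) ≤ B ^ d * (L ^ d * L ^ (-β)) := by
  have h : (B * L) ^ (-β) ≤ L ^ (-β) :=
    Real.rpow_le_rpow_of_nonpos hL (le_mul_of_one_le_left hL.le hB) (by linarith)
  calc (B * L) ^ d * (B * L) ^ (-β) ≤ (B * L) ^ d * L ^ (-β) :=
        mul_le_mul_of_nonneg_left h (by positivity)
    _ = B ^ d * (L ^ d * L ^ (-β)) := by rw [mul_pow]; ring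

/-- With D = δ(u), the kernel contributes (2^k D)^(-e) and the volume available to y contributes
(2^k D)^d. Their product gives the decay 2^(-(e-d)k); the weight factor is only estimated by D^(-β).
-/
theorem weight_product_le {B D e α β : ℝ} (hB : 1 ≤ B) (hD : 0 < D) (hβ : 0 ≤ β) (k : ℕ) :
    (2 ^ k * D) ^ (-e) * (D ^ d)⁻¹ * D ^ (-α) *
        ((B * (2 ^ k * D)) ^ d * (B * (2 ^ k * D)) ^ (-β)) ≤
      B ^ d * ((2 : ℝ) ^ (-(e - d))) ^ k * D ^ (-e - α - β) := by
  have hL : 0 < 2 ^ k * D := by positivity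
  have hDL : D ≤ 2 ^ k * D := le_mul_of_one_le_left hD.le (one_le_pow₀ one_le_two)
  have h1 : (2 ^ k * D) ^ (-β) ≤ D ^ (-β) := Real.rpow_le_rpow_of_nonpos hD hDL (by linarith)
  have h2 : (2 ^ k * D) ^ (-e) * (2 ^ k * D) ^ d =
      ((2 : ℝ) ^ (-(e - d))) ^ k * D ^ (-(e - d)) := by
    rw [← Real.rpow_natCast (2 ^ k * D) d, ← Real.rpow_add hL, Real.mul_rpow (by positivity) hD.le,
      ← Real.rpow_natCast, ← Real.rpow_natCast, ← Real.rpow_mul (by norm_num),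
      ← Real.rpow_mul (by norm_num)]
    ring_nf
  have h3 : D ^ (-(e - d)) * (D ^ d)⁻¹ * D ^ (-α) * D ^ (-β) = D ^ (-e - α - β) := by
    rw [← Real.rpow_natCast, ← Real.rpow_neg hD.le, ← Real.rpow_add hD, ← Real.rpow_add hD,
      ← Real.rpow_add hD]
    ring_nf
  calc _ ≤ (2 ^ k * D) ^ (-e) * (D ^ d)⁻¹ * D ^ (-α) *
        (B ^ d * ((2 ^ k * D) ^ d * D ^ (-β))) :=
        mul_le_mul_of_nonneg_left ((mul_rpow_neg_le hB hL hβ).trans (mul_le_mul_of_nonneg_left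
          (mul_le_mul_of_nonneg_left h1 (by positivity)) (by positivity))) (by positivity)
    _ = B ^ d * ((2 ^ k * D) ^ (-e) * (2 ^ k * D) ^ d) * ((D ^ d)⁻¹ * D ^ (-α) * D ^ (-β)) := by
        ring
    _ = B ^ d * ((2 : ℝ) ^ (-(e - d))) ^ k *
        (D ^ (-(e - d)) * (D ^ d)⁻¹ * D ^ (-α) * D ^ (-β)) := by rw [h2]; ring
    _ = _ := by rw [h3]

/-- Turns conditions on u given (x, y) into conditions on x and y given u, ready for Tonelli. The
scale ρ is comparable to δ(u) and |x - y| = 2 · 2^k ρ. The exponent j is 1 for the pointwise term of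
`scaleAvg` and 2 for the integral term. -/
theorem kernel_le_of_mem_scaleSet (hΩ : IsOpen Ω) (hF : (frontier Ω).Nonempty) {A e : ℝ}
    (hA : 1 ≤ A) (he : 0 ≤ e) {x y u : Euc d} {k : ℕ}
    (hu : u ∈ scaleSet A Ω x (dist x y / 2 / 2 ^ k)) (j : ℕ) :
    ENNReal.ofReal (dist x y ^ (-e)) * ENNReal.ofReal ((dist x y / 2 / 2 ^ k) ^ d)⁻¹ ^ j ≤
        ENNReal.ofReal (A ^ e * (A ^ d) ^ j * ((2 ^ k * bdryDist Ω u) ^ (-e) *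
          (bdryDist Ω u ^ d)⁻¹ ^ j)) ∧
      x ∈ Metric.ball u ((2 * A + A ^ 2 + 1) * (1 * bdryDist Ω u)) ∧
      y ∈ Metric.ball u ((2 * A + A ^ 2 + 1) * (2 ^ k * bdryDist Ω u)) := by
  obtain ⟨huΩ, h1, h2, h3⟩ := hu
  have hδ := bdryDist_pos hΩ hF huΩ
  set ρ := dist x y / 2 / 2 ^ k with hρdef
  set D := bdryDist Ω u
  have h2k : (1 : ℝ) ≤ 2 ^ k := one_le_pow₀ one_le_two
  have hR : dist x y = 2 * 2 ^ k * ρ := by rw [hρdef]; field_simp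
  have hρ : 0 < ρ := pos_of_mul_pos_right (hδ.trans_le h3) (by linarith)
  have hDA : D / A ≤ ρ := (div_le_iff₀ (by linarith)).2 (by linarith)
  have hAρ : A * ρ ≤ A * (A * D) := mul_le_mul_of_nonneg_left h2 (by linarith)
  have hDk : D ≤ 2 ^ k * D := le_mul_of_one_le_left hδ.le h2k
  refine ⟨?_, ?_, ?_⟩
  · rw [← ENNReal.ofReal_pow (by positivity), ← ENNReal.ofReal_mul (by positivity)]
    refine ENNReal.ofReal_le_ofReal ?_
    have e1 : dist x y ^ (-e) ≤ A ^ e * (2 ^ k * D) ^ (-e) := by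
      have h4 : 2 ^ k * D / A ≤ dist x y := by
        rw [hR, mul_div_assoc]; nlinarith
      have h5 := Real.rpow_le_rpow_of_nonpos (by positivity) h4 (show -e ≤ 0 by linarith)
      rwa [Real.div_rpow (by positivity) (by positivity), Real.rpow_neg (by positivity : 0 ≤ A),
        div_inv_eq_mul, mul_comm] at h5
    have e2 : (ρ ^ d)⁻¹ ≤ A ^ d * (D ^ d)⁻¹ := by
      have h5 : (ρ ^ d)⁻¹ ≤ ((D / A) ^ d)⁻¹ :=
        inv_anti₀ (by positivity) (pow_le_pow_left₀ (by positivity) hDA d)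
      rwa [div_pow D A, inv_div (D ^ d), div_eq_mul_inv] at h5
    calc dist x y ^ (-e) * (ρ ^ d)⁻¹ ^ j
        ≤ (A ^ e * (2 ^ k * D) ^ (-e)) * (A ^ d * (D ^ d)⁻¹) ^ j := by gcongr
      _ = _ := by rw [mul_pow]; ring
  · rw [Metric.mem_ball, dist_comm]
    nlinarith
  · rw [Metric.mem_ball, dist_comm]
    have h4 := dist_triangle u x y
    have h5 : 2 * 2 ^ k * ρ ≤ 2 * 2 ^ k * (A * D) := mul_le_mul_of_nonneg_left h2 (by positivity)
    have h6 : A ^ 2 * D ≤ A ^ 2 * (2 ^ k * D) := mul_le_mul_of_nonneg_left hDk (by positivity)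
    nlinarith

theorem lintegral_triple_product {X : Type*} [MeasurableSpace X] {μ : Measure X} [SFinite μ]
    {g : X → ℝ≥0∞} {P S : X → X → ℝ≥0∞} (hg : Measurable g)
    (hP : Measurable (Function.uncurry P)) (hS : Measurable (Function.uncurry S)) :
    ∫⁻ x, ∫⁻ y, ∫⁻ u, g u * (P u x * S u y) ∂μ ∂μ ∂μ =
      ∫⁻ u, g u * ((∫⁻ x, P u x ∂μ) * ∫⁻ y, S u y ∂μ) ∂μ := by
  have hPx : ∀ x, Measurable fun u => P u x := fun x => hP.comp measurable_prodMk_right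
  have hPu : ∀ u, Measurable (P u) := fun u => hP.comp measurable_prodMk_left
  have hSu : ∀ u, Measurable (S u) := fun u => hS.comp measurable_prodMk_left
  have hSi : Measurable fun u => ∫⁻ y, S u y ∂μ := hS.lintegral_prod_right'
  have h1 : ∀ x, ∫⁻ y, ∫⁻ u, g u * (P u x * S u y) ∂μ ∂μ =
      ∫⁻ u, g u * (P u x * ∫⁻ y, S u y ∂μ) ∂μ := fun x => by
    rw [lintegral_lintegral_swap]
    · refine lintegral_congr fun u => ?_
      rw [lintegral_const_mul _ ((hSu u).const_mul _), lintegral_const_mul _ (hSu u)]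
    · exact ((hg.comp measurable_snd).mul (((hPx x).comp measurable_snd).mul
        (hS.comp measurable_swap))).aemeasurable
  simp_rw [h1]
  rw [lintegral_lintegral_swap]
  · refine lintegral_congr fun u => ?_
    rw [lintegral_const_mul _ ((hPu u).mul_const _), lintegral_mul_const _ (hPu u)]
  · exact ((hg.comp measurable_snd).mul ((hP.comp measurable_swap).mul
      (hSi.comp measurable_snd))).aemeasurable

theorem measurable_ball_indicator (c : ℝ) {w : Euc d → ℝ≥0∞} (hw : Measurable w) (b : ℝ) :
    Measurable (Function.uncurry fun u y : Euc d =>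
      (Metric.ball u (b * (c * bdryDist Ω u))).indicator w y) := by
  have hS : MeasurableSet {z : Euc d × Euc d | dist z.2 z.1 < b * (c * bdryDist Ω z.1)} :=
    measurableSet_lt (measurable_snd.dist measurable_fst)
      (((continuous_bdryDist.measurable.comp measurable_fst).const_mul c).const_mul b)
  exact (hw.comp measurable_snd).indicator hS

theorem measurable_scaleAvg (hΩ : IsOpen Ω) (A : ℝ) {G : Euc d → ℝ≥0∞} (hG : Measurable G) :
    Measurable fun z : Euc d × ℝ => scaleAvg A Ω G z.1 z.2 := by
  have hS : MeasurableSet {z : (Euc d × ℝ) × Euc d | z.2 ∈ scaleSet A Ω z.1.1 z.1.2} := by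
    have hδ : Measurable fun z : (Euc d × ℝ) × Euc d => bdryDist Ω z.2 :=
      continuous_bdryDist.measurable.comp measurable_snd
    have hr : Measurable fun z : (Euc d × ℝ) × Euc d => z.1.2 := measurable_fst.snd
    exact (measurable_snd hΩ.measurableSet).inter
      ((measurableSet_le (measurable_snd.dist measurable_fst.fst) (hr.const_mul A)).inter
        ((measurableSet_le hr (hδ.const_mul A)).inter (measurableSet_le hδ (hr.const_mul A))))
  have hind : Measurable fun z : (Euc d × ℝ) × Euc d =>
      (scaleSet A Ω z.1.1 z.1.2).indicator G z.2 := (hG.comp measurable_snd).indicator hS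
  have hint : Measurable fun z : Euc d × ℝ => ∫⁻ u in scaleSet A Ω z.1 z.2, G u := by
    convert hind.lintegral_prod_right' (ν := (volume : Measure (Euc d))) using 2 with z
    have hm : MeasurableSet (scaleSet A Ω z.1 z.2) := hS.preimage measurable_prodMk_left
    exact (lintegral_indicator hm G).symm
  have hρ : Measurable fun z : Euc d × ℝ => ENNReal.ofReal (z.2 ^ d)⁻¹ :=
    ((measurable_snd.pow_const d).inv).ennreal_ofReal
  exact (hρ.mul (hind.comp (measurable_id.prodMk measurable_fst))).add
    ((hρ.pow_const 2).mul hint)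

/-- The integral of the normalized averages at relative scale `2⁻ᵏ` decays geometrically. -/
theorem lintegral_kernel_scaleAvg_le (hΩ : IsOpen Ω) (hF : (frontier Ω).Nonempty)
    {A e α β : ℝ} (hA : 1 ≤ A) (he : 0 ≤ e) (hα : 0 ≤ α) (hβ : 0 ≤ β) {Cα Cβ : ℝ≥0∞}
    (hCα : ∀ u ∈ Ω, ∀ R : ℝ, bdryDist Ω u ≤ R →
      ∫⁻ y in Ω ∩ Metric.ball u R, ENNReal.ofReal (bdryDist Ω y ^ (-α)) ≤
        Cα * ENNReal.ofReal (R ^ d * R ^ (-α)))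
    (hCβ : ∀ u ∈ Ω, ∀ R : ℝ, bdryDist Ω u ≤ R →
      ∫⁻ y in Ω ∩ Metric.ball u R, ENNReal.ofReal (bdryDist Ω y ^ (-β)) ≤
        Cβ * ENNReal.ofReal (R ^ d * R ^ (-β)))
    {G : Euc d → ℝ≥0∞} (hG : Measurable G) (k : ℕ) :
    ∫⁻ x in Ω, ∫⁻ y in Ω, ENNReal.ofReal (dist x y ^ (-e)) *
        ENNReal.ofReal (bdryDist Ω y ^ (-β)) * ENNReal.ofReal (bdryDist Ω x ^ (-α)) *
        scaleAvg A Ω G x (dist x y / 2 / 2 ^ k) ≤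
      (ENNReal.ofReal (A ^ e * A ^ d * (2 * A + A ^ 2 + 1) ^ d) * Cβ +
        ENNReal.ofReal (A ^ e * (A ^ d) ^ 2 * (2 * A + A ^ 2 + 1) ^ d * (2 * A + A ^ 2 + 1) ^ d) *
          (Cα * Cβ)) *
        ENNReal.ofReal (2 ^ (-(e - d))) ^ k *
        ∫⁻ u in Ω, G u * ENNReal.ofReal (bdryDist Ω u ^ (-e - α - β)) := by
  set B := 2 * A + A ^ 2 + 1 with hBdef
  have hB : 1 ≤ B := by nlinarith
  set wα : Euc d → ℝ≥0∞ := fun y => ENNReal.ofReal (bdryDist Ω y ^ (-α)) with hwα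
  set wβ : Euc d → ℝ≥0∞ := fun y => ENNReal.ofReal (bdryDist Ω y ^ (-β)) with hwβ
  have hwαm : Measurable wα := measurable_bdryDist_rpow α
  have hwβm : Measurable wβ := measurable_bdryDist_rpow β
  have hδm : Measurable (bdryDist Ω) := continuous_bdryDist.measurable
  set g : ℕ → Euc d → ℝ≥0∞ := fun j u => ENNReal.ofReal (A ^ e * (A ^ d) ^ j *
    ((2 ^ k * bdryDist Ω u) ^ (-e) * (bdryDist Ω u ^ d)⁻¹ ^ j)) * G u with hg
  have hgm : ∀ j, Measurable (g j) := fun j =>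
    (((((hδm.const_mul _).pow_const _).mul
      (((hδm.pow_const d).inv).pow_const j)).const_mul _).ennreal_ofReal).mul hG
  set P : Euc d → Euc d → ℝ≥0∞ := fun u x =>
    (Metric.ball u (B * (1 * bdryDist Ω u))).indicator wα x with hP
  set S : Euc d → Euc d → ℝ≥0∞ := fun u y =>
    (Metric.ball u (B * (2 ^ k * bdryDist Ω u))).indicator wβ y with hS
  have hPm : Measurable (Function.uncurry P) := measurable_ball_indicator 1 hwαm B
  have hSm : Measurable (Function.uncurry S) := measurable_ball_indicator (2 ^ k) hwβm B
  have hSi : ∀ u ∈ Ω, ∫⁻ y in Ω, S u y ≤ Cβ * ENNReal.ofReal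
      ((B * (2 ^ k * bdryDist Ω u)) ^ d * (B * (2 ^ k * bdryDist Ω u)) ^ (-β)) := fun u hu => by
    have hδ := bdryDist_pos hΩ hF hu
    rw [hS, setLIntegral_indicator measurableSet_ball, inter_comm]
    refine hCβ u hu _ ?_
    have h2k : (1 : ℝ) ≤ 2 ^ k := one_le_pow₀ one_le_two
    nlinarith [le_mul_of_one_le_left hδ.le h2k]
  have hPi : ∀ u ∈ Ω, ∫⁻ x in Ω, P u x ≤ Cα * ENNReal.ofReal
      ((B * bdryDist Ω u) ^ d * (B * bdryDist Ω u) ^ (-α)) := fun u hu => by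
    have hδ := bdryDist_pos hΩ hF hu
    rw [hP, setLIntegral_indicator measurableSet_ball, inter_comm, one_mul]
    exact hCα u hu _ (by nlinarith)
  -- In the pointwise term x itself plays the role of u, so only y is left to integrate and only Cβ
  -- appears; the integral term produces Cα Cβ.
  have hdom : ∀ x ∈ Ω, ∀ y ∈ Ω, ENNReal.ofReal (dist x y ^ (-e)) * wβ y * wα x *
      scaleAvg A Ω G x (dist x y / 2 / 2 ^ k) ≤
      g 1 x * (wα x * S x y) + ∫⁻ u in Ω, g 2 u * (P u x * S u y) := by
    intro x hx y hy
    rw [scaleAvg, mul_add]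
    refine add_le_add ?_ ?_
    · by_cases hxs : x ∈ scaleSet A Ω x (dist x y / 2 / 2 ^ k)
      · obtain ⟨h1, -, h3⟩ := kernel_le_of_mem_scaleSet hΩ hF hA he hxs 1
        rw [indicator_of_mem hxs, hS]
        simp only
        rw [indicator_of_mem h3]
        calc _ = (ENNReal.ofReal (dist x y ^ (-e)) *
              ENNReal.ofReal ((dist x y / 2 / 2 ^ k) ^ d)⁻¹ ^ 1) * G x * (wα x * wβ y) := by ring
          _ ≤ _ := mul_le_mul_left (mul_le_mul_left h1 _) _
      · rw [indicator_of_notMem hxs, mul_zero, mul_zero]; exact zero_le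
    · have hsm : MeasurableSet (scaleSet A Ω x (dist x y / 2 / 2 ^ k)) :=
        hΩ.measurableSet.inter ((measurableSet_le (measurable_id.dist measurable_const)
          measurable_const).inter ((measurableSet_le measurable_const (hδm.const_mul A)).inter
            (measurableSet_le hδm measurable_const)))
      have hct : ENNReal.ofReal (dist x y ^ (-e)) * wβ y * wα x *
          ENNReal.ofReal ((dist x y / 2 / 2 ^ k) ^ d)⁻¹ ^ 2 ≠ ∞ := by
        simp only [hwα, hwβ]
        finiteness
      rw [← mul_assoc, ← lintegral_const_mul' _ _ hct]
      refine le_trans (setLIntegral_mono' hsm fun u hu => ?_)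
        (lintegral_mono_set fun u hu => hu.1)
      obtain ⟨h1, h2, h3⟩ := kernel_le_of_mem_scaleSet hΩ hF hA he hu 2
      simp only [hP, hS]
      rw [indicator_of_mem h2, indicator_of_mem h3]
      calc _ = (ENNReal.ofReal (dist x y ^ (-e)) *
            ENNReal.ofReal ((dist x y / 2 / 2 ^ k) ^ d)⁻¹ ^ 2) * G u * (wα x * wβ y) := by ring
        _ ≤ _ := mul_le_mul_left (mul_le_mul_left h1 _) _
  have hpt1 : ∀ u ∈ Ω, g 1 u * (wα u * ∫⁻ y in Ω, S u y) ≤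
      ENNReal.ofReal (A ^ e * A ^ d * B ^ d) * Cβ * ENNReal.ofReal (2 ^ (-(e - d))) ^ k *
        (G u * ENNReal.ofReal (bdryDist Ω u ^ (-e - α - β))) := fun u hu => by
    have hδ := bdryDist_pos hΩ hF hu
    refine (mul_le_mul_right (mul_le_mul_right (hSi u hu) _) _).trans ?_
    have key : ENNReal.ofReal (A ^ e * (A ^ d) ^ 1 *
          ((2 ^ k * bdryDist Ω u) ^ (-e) * (bdryDist Ω u ^ d)⁻¹ ^ 1)) *
        ENNReal.ofReal (bdryDist Ω u ^ (-α)) * ENNReal.ofReal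
          ((B * (2 ^ k * bdryDist Ω u)) ^ d * (B * (2 ^ k * bdryDist Ω u)) ^ (-β)) ≤
        ENNReal.ofReal (A ^ e * A ^ d * B ^ d) * ENNReal.ofReal (2 ^ (-(e - d))) ^ k *
          ENNReal.ofReal (bdryDist Ω u ^ (-e - α - β)) := by
      rw [← ENNReal.ofReal_pow (by positivity), ← ENNReal.ofReal_mul (by positivity),
        ← ENNReal.ofReal_mul (by positivity), ← ENNReal.ofReal_mul (by positivity),
        ← ENNReal.ofReal_mul (by positivity)]
      refine ENNReal.ofReal_le_ofReal ?_
      have := mul_le_mul_of_nonneg_left (weight_product_le (d := d) (e := e) (α := α) hB hδ hβ k)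
        (show 0 ≤ A ^ e * A ^ d by positivity)
      refine (le_of_eq ?_).trans (this.trans (le_of_eq ?_)) <;> ring
    calc _ = (ENNReal.ofReal (A ^ e * (A ^ d) ^ 1 *
          ((2 ^ k * bdryDist Ω u) ^ (-e) * (bdryDist Ω u ^ d)⁻¹ ^ 1)) *
        ENNReal.ofReal (bdryDist Ω u ^ (-α)) * ENNReal.ofReal
          ((B * (2 ^ k * bdryDist Ω u)) ^ d * (B * (2 ^ k * bdryDist Ω u)) ^ (-β))) *
          (G u * Cβ) := by simp only [hg, hwα]; ring
      _ ≤ _ := mul_le_mul_left key _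
      _ = _ := by ring
  have hpt2 : ∀ u ∈ Ω, g 2 u * ((∫⁻ x in Ω, P u x) * ∫⁻ y in Ω, S u y) ≤
      ENNReal.ofReal (A ^ e * (A ^ d) ^ 2 * B ^ d * B ^ d) * (Cα * Cβ) *
        ENNReal.ofReal (2 ^ (-(e - d))) ^ k *
        (G u * ENNReal.ofReal (bdryDist Ω u ^ (-e - α - β))) := fun u hu => by
    have hδ := bdryDist_pos hΩ hF hu
    refine (mul_le_mul_right (mul_le_mul' (hPi u hu) (hSi u hu)) _).trans ?_
    have key : ENNReal.ofReal (A ^ e * (A ^ d) ^ 2 *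
          ((2 ^ k * bdryDist Ω u) ^ (-e) * (bdryDist Ω u ^ d)⁻¹ ^ 2)) *
        ENNReal.ofReal ((B * bdryDist Ω u) ^ d * (B * bdryDist Ω u) ^ (-α)) * ENNReal.ofReal
          ((B * (2 ^ k * bdryDist Ω u)) ^ d * (B * (2 ^ k * bdryDist Ω u)) ^ (-β)) ≤
        ENNReal.ofReal (A ^ e * (A ^ d) ^ 2 * B ^ d * B ^ d) *
          ENNReal.ofReal (2 ^ (-(e - d))) ^ k *
          ENNReal.ofReal (bdryDist Ω u ^ (-e - α - β)) := by
      rw [← ENNReal.ofReal_pow (by positivity), ← ENNReal.ofReal_mul (by positivity),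
        ← ENNReal.ofReal_mul (by positivity), ← ENNReal.ofReal_mul (by positivity),
        ← ENNReal.ofReal_mul (by positivity)]
      refine ENNReal.ofReal_le_ofReal ?_
      have h1 := mul_le_mul_of_nonneg_left
        (weight_product_le (d := d) (e := e) (α := α) hB hδ hβ k)
        (show 0 ≤ A ^ e * (A ^ d) ^ 2 * B ^ d by positivity)
      set D := bdryDist Ω u
      set W := (B * (2 ^ k * D)) ^ d * (B * (2 ^ k * D)) ^ (-β) with hW
      have hW0 : 0 ≤ W := by positivity
      calc _ ≤ A ^ e * (A ^ d) ^ 2 * ((2 ^ k * D) ^ (-e) * (D ^ d)⁻¹ ^ 2) *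
            (B ^ d * (D ^ d * D ^ (-α))) * W :=
            mul_le_mul_of_nonneg_right (mul_le_mul_of_nonneg_left (mul_rpow_neg_le hB hδ hα)
              (by positivity)) hW0
        _ = A ^ e * (A ^ d) ^ 2 * B ^ d * ((2 ^ k * D) ^ (-e) * (D ^ d)⁻¹ * D ^ (-α) * W) *
            ((D ^ d)⁻¹ * D ^ d) := by ring
        _ = A ^ e * (A ^ d) ^ 2 * B ^ d * ((2 ^ k * D) ^ (-e) * (D ^ d)⁻¹ * D ^ (-α) * W) := by
            rw [inv_mul_cancel₀ (by positivity), mul_one]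
        _ ≤ _ := h1
        _ = _ := by ring
    calc _ = (ENNReal.ofReal (A ^ e * (A ^ d) ^ 2 *
          ((2 ^ k * bdryDist Ω u) ^ (-e) * (bdryDist Ω u ^ d)⁻¹ ^ 2)) *
        ENNReal.ofReal ((B * bdryDist Ω u) ^ d * (B * bdryDist Ω u) ^ (-α)) * ENNReal.ofReal
          ((B * (2 ^ k * bdryDist Ω u)) ^ d * (B * (2 ^ k * bdryDist Ω u)) ^ (-β))) *
          (G u * (Cα * Cβ)) := by simp only [hg]; ring
      _ ≤ _ := mul_le_mul_left key _
      _ = _ := by ring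
  have hFa : Measurable (Function.uncurry fun x y => g 1 x * (wα x * S x y)) :=
    ((hgm 1).comp measurable_fst).mul ((hwαm.comp measurable_fst).mul hSm)
  have hWm : Measurable fun u => G u * ENNReal.ofReal (bdryDist Ω u ^ (-e - α - β)) :=
    hG.mul ((hδm.pow_const _).ennreal_ofReal)
  have hFi : Measurable fun x => ∫⁻ y in Ω, g 1 x * (wα x * S x y) :=
    Measurable.lintegral_prod_right' (f := Function.uncurry fun x y => g 1 x * (wα x * S x y)) hFa
  have hFx : ∀ x, Measurable fun y => g 1 x * (wα x * S x y) :=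
    fun x => hFa.of_uncurry_left
  have hSx : ∀ x, Measurable (S x) := fun x => hSm.of_uncurry_left
  have hsplit : ∫⁻ x in Ω, ∫⁻ y in Ω, (g 1 x * (wα x * S x y) +
      ∫⁻ u in Ω, g 2 u * (P u x * S u y)) =
      (∫⁻ u in Ω, g 1 u * (wα u * ∫⁻ y in Ω, S u y)) +
        ∫⁻ u in Ω, g 2 u * ((∫⁻ x in Ω, P u x) * ∫⁻ y in Ω, S u y) := by
    rw [← lintegral_triple_product (hgm 2) hPm hSm]
    simp_rw [lintegral_add_left (hFx _)]
    rw [lintegral_add_left hFi]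
    simp_rw [lintegral_const_mul _ ((hSx _).const_mul _), lintegral_const_mul _ (hSx _)]
  have hend := add_le_add (setLIntegral_mono' (μ := volume) hΩ.measurableSet hpt1)
    (setLIntegral_mono' (μ := volume) hΩ.measurableSet hpt2)
  rw [lintegral_const_mul _ hWm, lintegral_const_mul _ hWm, ← add_mul, ← add_mul, ← hsplit] at hend
  refine le_trans ?_ hend
  exact setLIntegral_mono' hΩ.measurableSet fun x hx =>
    setLIntegral_mono' hΩ.measurableSet fun y hy => hdom x hx y hy

end Reduction

/-! ### Summation over the scales and comparability -/

section Comparability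

variable {d : ℕ} {Ω : Set (Euc d)} {𝕜 : Type*} [RCLike 𝕜]

theorem truncatedSeminormPow_le_fullSeminormPow (hΩ : IsOpen Ω) (s p α β : ℝ) {θ : ℝ}
    (hθ : θ ≤ 1) (f : Euc d → 𝕜) :
    truncatedSeminormPow Ω s p α β θ f ≤ fullSeminormPow Ω s p α β f :=
  setLIntegral_mono' hΩ.measurableSet fun _ hx =>
    lintegral_mono_set (ball_mul_bdryDist_subset hΩ hθ hx)

theorem gagliardoIntegrand_congr (s p α β : ℝ) {f g : Euc d → 𝕜} {x y : Euc d} (hx : f x = g x)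
    (hy : f y = g y) : gagliardoIntegrand Ω s p α β f x y = gagliardoIntegrand Ω s p α β g x y := by
  rw [gagliardoIntegrand, gagliardoIntegrand, hx, hy]

theorem fullSeminormPow_congr_ae (s p α β : ℝ) {f g : Euc d → 𝕜}
    (h : f =ᵐ[volume.restrict Ω] g) :
    fullSeminormPow Ω s p α β f = fullSeminormPow Ω s p α β g := by
  refine lintegral_congr_ae ?_
  filter_upwards [h] with x hx
  refine lintegral_congr_ae ?_
  filter_upwards [h] with y hy
  exact gagliardoIntegrand_congr s p α β hx hy

theorem truncatedSeminormPow_congr_ae (hΩ : IsOpen Ω) (s p α β : ℝ) {θ : ℝ} (hθ : θ ≤ 1)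
    {f g : Euc d → 𝕜} (h : f =ᵐ[volume.restrict Ω] g) :
    truncatedSeminormPow Ω s p α β θ f = truncatedSeminormPow Ω s p α β θ g := by
  refine lintegral_congr_ae ?_
  filter_upwards [h, ae_restrict_mem hΩ.measurableSet] with x hx hxΩ
  refine lintegral_congr_ae ?_
  filter_upwards [ae_restrict_of_ae_restrict_of_subset (ball_mul_bdryDist_subset hΩ hθ hxΩ) h]
    with y hy
  exact gagliardoIntegrand_congr s p α β hx hy

theorem measurable_scaleAvg_comp (hΩ : IsOpen Ω) (A : ℝ) {G : Euc d → ℝ≥0∞} (hG : Measurable G)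
    {X : Type*} [MeasurableSpace X] {φ : X → Euc d} {ρ : X → ℝ} (hφ : Measurable φ)
    (hρ : Measurable ρ) : Measurable fun z => scaleAvg A Ω G (φ z) (ρ z) :=
  (measurable_scaleAvg hΩ A hG).comp (hφ.prodMk hρ)

theorem exists_full_le_truncated (hd : 1 ≤ d) (hne : Ω.Nonempty) (hbdd : Bornology.IsBounded Ω)
    (hunif : IsUniformDomain Ω) {s p θ α β : ℝ} (hs : 0 < s) (hp : 1 ≤ p) (hθ0 : 0 < θ)
    (hθ1 : θ ≤ 1) (hα0 : 0 ≤ α) (hα : ENNReal.ofReal α < lowerAssouadCodim (frontier Ω))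
    (hβ0 : 0 ≤ β) (hβ : ENNReal.ofReal β < lowerAssouadCodim (frontier Ω)) :
    ∃ C : ℝ≥0∞, C ≠ ∞ ∧ ∀ f : Euc d → 𝕜, StronglyMeasurable f →
      fullSeminormPow Ω s p α β f ≤ C * truncatedSeminormPow Ω s p α β θ f := by
  have hΩ := hunif.isOpen
  have hF := frontier_nonempty_of_isBounded hd hne hbdd
  obtain ⟨K, hK, hU⟩ := hunif.exists_uniformWith
  obtain ⟨Cα, hCαt, hCα⟩ := exists_weight_bound hd hΩ hne hbdd hα0 hα
  obtain ⟨Cβ, hCβt, hCβ⟩ := exists_weight_bound hd hΩ hne hbdd hβ0 hβ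
  have hp0 : 0 < p := by linarith
  -- If |x - y| ≥ θδ(x), then θδ(y) ≤ (1 + θ)|x - y| ≤ 2|x - y|, so both points satisfy the
  -- separation condition of `UniformWith.edist_rpow_le`.
  set κ := θ / 4 with hκdef
  have hκ0 : 0 < κ := by positivity
  have hκ1 : κ ≤ 1 := by rw [hκdef]; linarith
  set A := 16 * K ^ 2 + 2 / κ with hA
  have hA1 : 1 ≤ A := by
    have h1 : 1 ≤ K ^ 2 := one_le_pow₀ hK
    have h2 : 0 < 2 / κ := by positivity
    linarith
  obtain ⟨C₁, hC₁t, hC₁⟩ := hU.edist_rpow_le (F := 𝕜) hK hΩ hF hκ0 hκ1 hp0 (t := s / 2)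
    (by positivity) hA.symm.le
  set e := (d : ℝ) + s * p with hedef
  have he : 0 ≤ e := by positivity
  set cst : ℝ≥0∞ → ℝ≥0∞ := fun c => ENNReal.ofReal (A ^ e * A ^ d * (2 * A + A ^ 2 + 1) ^ d) * c +
    ENNReal.ofReal (A ^ e * (A ^ d) ^ 2 * (2 * A + A ^ 2 + 1) ^ d * (2 * A + A ^ 2 + 1) ^ d) *
      (Cα * Cβ) with hcst
  have hcstt : ∀ c, c ≠ ∞ → cst c ≠ ∞ := fun c hc => by
    simp only [hcst]
    finiteness
  set a : ℝ≥0∞ := 2 ^ (s / 2 * p) with ha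
  set b : ℝ≥0∞ := ENNReal.ofReal (2 ^ (-(e - d))) with hb
  -- The loss 2^(sp/2) per level, from t = s/2, is beaten by the decay 2^(-sp).
  have hab : a * b < 1 := by
    have hb' : b = 2 ^ (-(s * p)) := by
      rw [hb, hedef, add_sub_cancel_left, ← ENNReal.ofReal_rpow_of_pos (by norm_num)]
      norm_num
    rw [hb', ha, ← ENNReal.rpow_add _ _ (by norm_num) (by norm_num)]
    refine ENNReal.rpow_lt_one_of_one_lt_of_neg (by norm_num) ?_
    nlinarith [mul_pos hs hp0]
  set L : ℝ≥0∞ := (1 - a * b)⁻¹ with hL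
  have hLt : L ≠ ∞ := ENNReal.inv_ne_top.2 (tsub_pos_of_lt hab).ne'
  set C₂ := ENNReal.ofReal (κ ^ e * 2 ^ β) with hC₂
  refine ⟨1 + C₁ * ((cst Cβ + cst Cα) * L) * C₂, ?_, fun f hf => ?_⟩
  · have h1 := hcstt Cα hCαt
    have h2 := hcstt Cβ hCβt
    finiteness
  set G := localOsc Ω κ p f with hG
  have hGm : Measurable G := measurable_localOsc hf κ p
  set T := truncatedSeminormPow Ω s p α β θ f with hT
  set ker : Euc d → Euc d → ℝ≥0∞ := fun x y => ENNReal.ofReal (dist x y ^ (-e)) *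
    ENNReal.ofReal (bdryDist Ω y ^ (-β)) * ENNReal.ofReal (bdryDist Ω x ^ (-α)) with hker
  have hkerm : Measurable (Function.uncurry ker) :=
    (((measurable_fst.dist measurable_snd).pow_const _).ennreal_ofReal.mul
      ((measurable_bdryDist_rpow β).comp measurable_snd)).mul
      ((measurable_bdryDist_rpow α).comp measurable_fst)
  set H : ℕ → Euc d → Euc d → ℝ≥0∞ := fun k x y =>
    ker x y * scaleAvg A Ω G x (dist x y / 2 / 2 ^ k) with hH
  set H' : ℕ → Euc d → Euc d → ℝ≥0∞ := fun k x y =>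
    ker x y * scaleAvg A Ω G y (dist x y / 2 / 2 ^ k) with hH'
  have hρm : ∀ k : ℕ, Measurable fun z : Euc d × Euc d => dist z.1 z.2 / 2 / 2 ^ k := fun k =>
    ((measurable_fst.dist measurable_snd).div_const _).div_const _
  have hHm : ∀ k, Measurable (Function.uncurry (H k)) := fun k =>
    hkerm.mul (measurable_scaleAvg_comp hΩ A hGm measurable_fst (hρm k))
  have hHm' : ∀ k, Measurable (Function.uncurry (H' k)) := fun k =>
    hkerm.mul (measurable_scaleAvg_comp hΩ A hGm measurable_snd (hρm k))
  set M : ℕ → Euc d → Euc d → ℝ≥0∞ := fun k x y => a ^ k * (H k x y + H' k x y) with hM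
  have hMm : ∀ k, Measurable (Function.uncurry (M k)) := fun k =>
    ((hHm k).add (hHm' k)).const_mul (a ^ k)
  set W := ∫⁻ u in Ω, G u * ENNReal.ofReal (bdryDist Ω u ^ (-e - α - β)) with hW
  have hWT : W ≤ C₂ * T := lintegral_localOsc_le hΩ hF hs hp0 hκ0 (by linarith) hκ1 hβ0 f
  have hHi : ∀ k, ∫⁻ x in Ω, ∫⁻ y in Ω, H k x y ≤ cst Cβ * b ^ k * W := fun k =>
    lintegral_kernel_scaleAvg_le hΩ hF hA1 he hα0 hβ0 hCα hCβ hGm k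
  -- The terms centred at y reduce to those centred at x by exchanging the variables together with α
  -- and β.
  have hHi' : ∀ k, ∫⁻ x in Ω, ∫⁻ y in Ω, H' k x y ≤ cst Cα * b ^ k * W := fun k => by
    rw [lintegral_lintegral_swap (hHm' k).aemeasurable]
    have := lintegral_kernel_scaleAvg_le hΩ hF hA1 he hβ0 hα0 hCβ hCα hGm k
    rw [mul_comm Cβ Cα] at this
    refine (le_of_eq ?_).trans (this.trans (le_of_eq ?_))
    · refine lintegral_congr fun y => lintegral_congr fun x => ?_
      simp only [hH', hker, dist_comm x y]
      ring
    · simp only [hW, sub_right_comm]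
      rfl
  have hMi : ∀ k, ∫⁻ x in Ω, ∫⁻ y in Ω, M k x y ≤ (cst Cβ + cst Cα) * W * (a * b) ^ k := fun k => by
    have h1 : ∫⁻ x in Ω, ∫⁻ y in Ω, M k x y =
        a ^ k * ((∫⁻ x in Ω, ∫⁻ y in Ω, H k x y) + ∫⁻ x in Ω, ∫⁻ y in Ω, H' k x y) := by
      have m1 : Measurable fun x => ∫⁻ y in Ω, H k x y :=
        Measurable.lintegral_prod_right' (f := Function.uncurry (H k)) (hHm k)
      have m2 : Measurable fun x => ∫⁻ y in Ω, H' k x y :=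
        Measurable.lintegral_prod_right' (f := Function.uncurry (H' k)) (hHm' k)
      have m12 : Measurable fun x => (∫⁻ y in Ω, H k x y) + ∫⁻ y in Ω, H' k x y := m1.add m2
      rw [← lintegral_add_left m1, ← lintegral_const_mul _ m12]
      refine lintegral_congr fun x => ?_
      have m3 : Measurable (H k x) := (hHm k).of_uncurry_left
      have m4 : Measurable (H' k x) := (hHm' k).of_uncurry_left
      have m34 : Measurable fun y => H k x y + H' k x y := m3.add m4
      rw [← lintegral_add_left m3, ← lintegral_const_mul _ m34]
    rw [h1]
    refine (mul_le_mul_right (add_le_add (hHi k) (hHi' k)) _).trans (le_of_eq ?_)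
    rw [mul_pow]; ring
  have hpt : ∀ x ∈ Ω, ∀ y ∈ Ω, gagliardoIntegrand Ω s p α β f x y ≤
      (Metric.ball x (θ * bdryDist Ω x)).indicator (gagliardoIntegrand Ω s p α β f x) y +
        C₁ * ∑' k, M k x y := by
    intro x hx y hy
    by_cases hxy : y ∈ Metric.ball x (θ * bdryDist Ω x)
    · rw [indicator_of_mem hxy]; exact le_self_add
    refine le_trans ?_ le_add_self
    have hδ := bdryDist_pos hΩ hF hx
    rw [Metric.mem_ball, not_lt, dist_comm] at hxy
    have hne' : x ≠ y := fun h => by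
      rw [h, dist_self, ← h] at hxy
      nlinarith [mul_pos hθ0 hδ]
    have hbd := bdryDist_le_add_dist (Ω := Ω) y x
    rw [dist_comm] at hbd
    have hR : 0 ≤ dist x y := dist_nonneg
    have h1 := hC₁ f hf x hx y hy hne' (by rw [hκdef]; nlinarith) (by rw [hκdef]; nlinarith)
    rw [gagliardoIntegrand_eq s hp0.le]
    refine (mul_le_mul_left h1 _).trans (le_of_eq ?_)
    rw [mul_assoc, ← ENNReal.tsum_mul_right]
    congr 1
    refine tsum_congr fun k => ?_
    simp only [hM, hH, hH', hker]
    ring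
  have hSm : Measurable (Function.uncurry fun x y => ∑' k, M k x y) :=
    Measurable.tsum hMm
  have hsum : ∫⁻ x in Ω, ∫⁻ y in Ω, ∑' k, M k x y ≤ (cst Cβ + cst Cα) * L * W := by
    have h1 : ∫⁻ x in Ω, ∫⁻ y in Ω, ∑' k, M k x y = ∑' k, ∫⁻ x in Ω, ∫⁻ y in Ω, M k x y := by
      have m1 : ∀ k, Measurable fun x => ∫⁻ y in Ω, M k x y := fun k =>
        Measurable.lintegral_prod_right' (f := Function.uncurry (M k)) (hMm k)
      rw [← lintegral_tsum fun k => (m1 k).aemeasurable]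
      refine lintegral_congr fun x => ?_
      exact lintegral_tsum fun k => ((hMm k).of_uncurry_left (x := x)).aemeasurable
    rw [h1]
    refine (ENNReal.tsum_le_tsum hMi).trans (le_of_eq ?_)
    rw [ENNReal.tsum_mul_left, ENNReal.tsum_geometric, hL]
    ring
  have hfull : fullSeminormPow Ω s p α β f ≤ T + C₁ * ((cst Cβ + cst Cα) * L * W) := by
    calc fullSeminormPow Ω s p α β f
        ≤ ∫⁻ x in Ω, ((∫⁻ y in Metric.ball x (θ * bdryDist Ω x),
            gagliardoIntegrand Ω s p α β f x y) + C₁ * ∫⁻ y in Ω, ∑' k, M k x y) := by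
          refine setLIntegral_mono' hΩ.measurableSet fun x hx => ?_
          have hm : Measurable fun y => ∑' k, M k x y := hSm.of_uncurry_left
          refine (setLIntegral_mono' hΩ.measurableSet (hpt x hx)).trans ?_
          rw [lintegral_add_right _ (hm.const_mul _), lintegral_const_mul _ hm,
            setLIntegral_indicator measurableSet_ball]
          exact add_le_add (lintegral_mono_set inter_subset_left) le_rfl
      _ = T + C₁ * ∫⁻ x in Ω, ∫⁻ y in Ω, ∑' k, M k x y := by
          have hm : Measurable fun x => ∫⁻ y in Ω, ∑' k, M k x y :=
            Measurable.lintegral_prod_right' (f := Function.uncurry fun x y => ∑' k, M k x y) hSm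
          rw [lintegral_add_right _ (hm.const_mul _), lintegral_const_mul _ hm]
          rfl
      _ ≤ _ := add_le_add le_rfl (mul_le_mul_right hsum _)
  refine hfull.trans ?_
  calc T + C₁ * ((cst Cβ + cst Cα) * L * W) ≤ T + C₁ * ((cst Cβ + cst Cα) * L * (C₂ * T)) := by
        gcongr
    _ = _ := by ring

end Comparability

theorem theorem1p1 {𝕜 : Type*} [RCLike 𝕜] (d : ℕ) (hd : 1 ≤ d) (Ω : Set (Euc d))
    (hne : Ω.Nonempty) (hbdd : Bornology.IsBounded Ω) (hunif : IsUniformDomain Ω)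
    (s p θ α β : ℝ) (hs0 : 0 < s) (hs1 : s < 1) (hp : 1 ≤ p) (hθ0 : 0 < θ) (hθ1 : θ ≤ 1)
    (hα0 : 0 ≤ α) (hα : ENNReal.ofReal α < lowerAssouadCodim (frontier Ω))
    (hβ0 : 0 ≤ β) (hβ : ENNReal.ofReal β < lowerAssouadCodim (frontier Ω)) :
    ∃ C : ℝ, 0 < C ∧ ∀ f : Euc d → 𝕜, LocallyIntegrableOn f Ω volume →
      truncatedSeminormPow Ω s p α β θ f ≤ fullSeminormPow Ω s p α β f ∧
      fullSeminormPow Ω s p α β f ≤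
        ENNReal.ofReal C * truncatedSeminormPow Ω s p α β θ f := by
  obtain ⟨C, hC, h⟩ := exists_full_le_truncated (𝕜 := 𝕜) hd hne hbdd hunif hs0 hp hθ0 hθ1 hα0 hα
    hβ0 hβ
  refine ⟨C.toReal + 1, by positivity, fun f hf =>
    ⟨truncatedSeminormPow_le_fullSeminormPow hunif.isOpen s p α β hθ1 f, ?_⟩⟩
  -- Both seminorms ignore null sets of Ω, so f may be replaced by a strongly measurable
  -- representative.
  have hfm := hf.aestronglyMeasurable
  rw [fullSeminormPow_congr_ae s p α β hfm.ae_eq_mk,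
    truncatedSeminormPow_congr_ae hunif.isOpen s p α β hθ1 hfm.ae_eq_mk]
  refine (h _ hfm.stronglyMeasurable_mk).trans (mul_le_mul_left ?_ _)
  rw [ENNReal.ofReal_add ENNReal.toReal_nonneg zero_le_one, ENNReal.ofReal_toReal hC]
  exact le_self_add
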